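/- Let $n\ge 2$ and $q,r\ge 1$. For $t\ge 1$ let $\mathfrak{C}_{n,t}=\{1,\ldots,t\}\times\{1,\ldots,n\}^{\omega}$ with the product topology. For a finite prefix $\alpha\in\{1,\ldots,t\}\times\{1,\ldots,n\}^*$, the cone $C_\alpha$ is the set of all points of $\mathfrak{C}_{n,t}$ having $\alpha$ as a prefix. The Higman--Thompson group $V_{n,t}$ is the group, under composition, of all homeomorphisms $f$ of $\mathfrak{C}_{n,t}$ such that every point lies in some cone $C_\alpha$ on which $f$ is a prefix replacement $\alpha\psi\mapsto\beta\psi$. A point of $\mathfrak{C}_{n,t}$ is rational if its sequence of digits is eventually repeating. For $S\subset\mathfrak{C}_{n,t}$, let $\mathrm{Fix}(S)$ be the subgroup of all elements of $V_{n,t}$ that fix every point of $S$. Let $S\subset\mathfrak{C}_{n,q}$ and $S'\subset\mathfrak{C}_{n,r}$ be finite sets of rational points, not both empty. Then the groups $\mathrm{Fix}(S)$ and $\mathrm{Fix}(S')$ are isomorphic if and only if $|S|=|S'|$. -/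

import Mathlib

namespace HigmanThompson

/-- The Cantor space `{1,…,r} × {1,…,n}^ω`, with the product topology of the discrete
topologies. -/
abbrev CantorSpace (n r : ℕ) : Type := Fin r × (ℕ → Fin n)

/-- Finite prefixes: a first digit in `{1,…,r}` followed by a finite word in `{1,…,n}*`. -/
abbrev Prefix (n r : ℕ) : Type := Fin r × List (Fin n)

/-- The infinite word `wψ` obtained by writing the finite word `w` in front of `ψ`. -/
def prepend {n : ℕ} (w : List (Fin n)) (ψ : ℕ → Fin n) : ℕ → Fin n :=
  fun k => if h : k < w.length then w[k] else ψ (k - w.length)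

/-- The point `αψ` of the Cantor space. -/
def Prefix.append {n r : ℕ} (α : Prefix n r) (ψ : ℕ → Fin n) : CantorSpace n r :=
  (α.1, prepend α.2 ψ)

/-- The cone `C_α`: all points that have `α` as a prefix. -/
def cone {n r : ℕ} (α : Prefix n r) : Set (CantorSpace n r) :=
  Set.range α.append

/-- The map `f` restricts on the cone `C_α` to the prefix replacement `αψ ↦ βψ`. -/
def ActsAsPrefixReplacement {n q r : ℕ} (f : CantorSpace n q → CantorSpace n r)
    (α : Prefix n q) (β : Prefix n r) : Prop :=
  ∀ ψ : ℕ → Fin n, f (α.append ψ) = β.append ψ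

/-- Each point lies in a cone on which `f` restricts to a prefix replacement. -/
def IsThompsonLike {n q r : ℕ} (f : CantorSpace n q → CantorSpace n r) : Prop :=
  ∀ x : CantorSpace n q, ∃ (α : Prefix n q) (β : Prefix n r),
    x ∈ cone α ∧ ActsAsPrefixReplacement f α β

theorem prepend_append {n : ℕ} (w v : List (Fin n)) (ψ : ℕ → Fin n) :
    prepend (w ++ v) ψ = prepend w (prepend v ψ) := by
  funext k
  unfold prepend
  by_cases h1 : k < w.length
  · have h2 : k < (w ++ v).length := by simp; omega
    simp [h1, List.getElem_append_left, show k < w.length + v.length by omega]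
  · by_cases h2 : k - w.length < v.length
    · simp [h1, h2, List.getElem_append_right (not_lt.mp h1),
        show k < w.length + v.length by omega]
    · simp [h1, h2, show ¬ k < w.length + v.length by omega, Nat.sub_add_eq]

theorem exists_suffix_of_prepend_eq {n : ℕ} {w v : List (Fin n)} {φ ψ : ℕ → Fin n}
    (h : prepend w φ = prepend v ψ) (hl : w.length ≤ v.length) :
    ∃ u, v = w ++ u ∧ φ = prepend u ψ := by
  have hv : v = w ++ v.drop w.length := by
    have : w = v.take w.length := by
      apply List.ext_getElem
      · simp [hl]
      · intro i h1 h2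
        have := congrFun h i
        simpa [prepend, h1, show i < v.length by omega] using this
    conv_lhs => rw [← List.take_append_drop w.length v]
    rw [← this]
  refine ⟨v.drop w.length, hv, ?_⟩
  rw [hv, prepend_append] at h
  funext k
  simpa [prepend] using congrFun h (w.length + k)

theorem append_append {n r : ℕ} (a : Fin r) (w u : List (Fin n)) (ψ : ℕ → Fin n) :
    Prefix.append (a, w ++ u) ψ = Prefix.append (a, w) (prepend u ψ) := by
  simp [Prefix.append, prepend_append]

theorem IsThompsonLike.comp {n p q r : ℕ} {g : CantorSpace n q → CantorSpace n r}
    {f : CantorSpace n p → CantorSpace n q} (hg : IsThompsonLike g) (hf : IsThompsonLike f) :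
    IsThompsonLike (g ∘ f) := by
  intro x
  obtain ⟨⟨a, α⟩, ⟨b, β⟩, ⟨ψ, rfl⟩, hfα⟩ := hf x
  obtain ⟨⟨c, γ⟩, ⟨d, δ⟩, ⟨φ, hφ⟩, hgγ⟩ := hg (f (Prefix.append (a, α) ψ))
  rw [hfα] at hφ
  obtain ⟨hcb, hw⟩ := Prod.ext_iff.mp hφ
  simp only [Prefix.append] at hcb hw
  subst hcb
  rcases le_total γ.length β.length with hl | hl
  · obtain ⟨u, rfl, -⟩ := exists_suffix_of_prepend_eq hw hl
    refine ⟨(a, α), (d, δ ++ u), ⟨ψ, rfl⟩, fun ξ => ?_⟩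
    rw [Function.comp_apply, hfα, append_append, hgγ, append_append]
  · obtain ⟨u, rfl, hu⟩ := exists_suffix_of_prepend_eq hw.symm hl
    refine ⟨(a, α ++ u), (d, δ), ⟨φ, ?_⟩, fun ξ => ?_⟩
    · rw [append_append, hu]
    · rw [Function.comp_apply, append_append, hfα, ← append_append, hgγ]

/-- The Higman–Thompson group `V_{n,r}` of all Thompson-like homeomorphisms of the Cantor
space, under composition. -/
def V (n r : ℕ) : Subgroup (CantorSpace n r ≃ₜ CantorSpace n r) where
  carrier := {f | IsThompsonLike f}
  one_mem' x := ⟨(x.1, []), (x.1, []), ⟨x.2, rfl⟩, fun _ => rfl⟩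
  mul_mem' hg hf := hg.comp hf
  inv_mem' := by
    intro f hf x
    obtain ⟨α, β, ⟨ψ, hψ⟩, h⟩ := hf (f.symm x)
    refine ⟨β, α, ⟨ψ, ?_⟩, fun ξ => ?_⟩
    · rw [← h, hψ, f.apply_symm_apply]
    · rw [← h]
      exact f.symm_apply_apply _

/-- A point is rational if its sequence of digits is eventually repeating. -/
def IsRational {n r : ℕ} (p : CantorSpace n r) : Prop :=
  ∃ N m : ℕ, 0 < m ∧ ∀ k, N ≤ k → p.2 (k + m) = p.2 k

/-- The pointwise stabilizer `Fix(S)` of `S` in `V_{n,r}`. -/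
def Fix {n r : ℕ} (S : Set (CantorSpace n r)) : Subgroup (V n r) where
  carrier := {g | ∀ p ∈ S, (g : CantorSpace n r ≃ₜ CantorSpace n r) p = p}
  one_mem' _ _ := rfl
  mul_mem' := by
    intro f g hf hg p hp
    change f.1 (g.1 p) = p
    rw [hg p hp, hf p hp]
  inv_mem' := by
    intro f hf p hp
    change f.1.symm p = p
    rw [Homeomorph.symm_apply_eq, hf p hp]

end HigmanThompson

open Set Function
namespace HigmanThompson

variable {n q r : ℕ}

/-! The number of points of S is recovered from Fix(S) as a rank. Near p in S, an element g replaces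
the first M digits of p by its first K digits. The difference K − M depends only on g and p, and
these integers form a homomorphism `germHom` to ℤ^S. An element of the kernel is the identity near
S, so it comes from some V_{n,t} acting on the finitely many remaining cones. Each V_{n,t} is
generated by torsion (`torsionClosure_V`), hence so is the kernel (`ker_germHom_le`), while ℤ^S is
torsion-free. Thus |S| is an invariant of the group whenever `germHom` is surjective
(`card_le_of_surjective`).

At a point of minimal period l all degrees are multiples of l, so surjectivity can fail. Both
directions therefore pass through a model: `nonempty_fix_mulEquiv_zeroPoints` identifies Fix(S), for
S nonempty, with the stabilizer of the zero sequences below |S| roots. The isomorphism is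
conjugation by a bijection h that need not be Thompson-like: off S it is locally a prefix
replacement, and near p it turns insertion of one period into insertion of one digit 0.

To build h, the complement of S is cut into cones branching off the points of S, periodic along each
point, and finitely many leftover cones. Around a zero sequence, each ring of points with a given
number of leading zeros is cut into l(n−1) cones, matching one period of p (`exists_zero_words`).
The leftover cones are absorbed by shifting one infinite sequence of cones (`exists_absorb`), which
exists because S is nonempty. -/

/-! ### Words, digits and cones. -/

@[simp] theorem prepend_nil (ψ : ℕ → Fin n) : prepend [] ψ = ψ := by
  funext k; simp [prepend]

@[simp] theorem prepend_cons_zero (d : Fin n) (w : List (Fin n)) (ψ : ℕ → Fin n) :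
    prepend (d :: w) ψ 0 = d := by simp [prepend]

@[simp] theorem prepend_cons_succ (d : Fin n) (w : List (Fin n)) (ψ : ℕ → Fin n) (k : ℕ) :
    prepend (d :: w) ψ (k + 1) = prepend w ψ k := by simp [prepend]

theorem prepend_inj {w v : List (Fin n)} {φ ψ : ℕ → Fin n} (hl : w.length = v.length) :
    prepend w φ = prepend v ψ ↔ w = v ∧ φ = ψ := by
  refine ⟨fun h => ?_, fun h => by rw [h.1, h.2]⟩
  obtain ⟨u, hu, rfl⟩ := exists_suffix_of_prepend_eq h hl.le
  have : u = [] := by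
    have := congrArg List.length hu
    simp only [List.length_append] at this
    exact List.eq_nil_of_length_eq_zero (by omega)
  subst this
  simp_all

theorem prepend_injective (w : List (Fin n)) : Injective (prepend w) :=
  fun _ _ h => ((prepend_inj rfl).1 h).2

theorem append_injective (α : Prefix n q) : Injective α.append :=
  fun _ _ h => prepend_injective _ (congrArg Prod.snd h)

/-- The word formed by the first `N` digits of `x`. -/
def digits (x : ℕ → Fin n) (N : ℕ) : List (Fin n) := List.ofFn fun i : Fin N => x i

@[simp] theorem length_digits (x : ℕ → Fin n) (N : ℕ) : (digits x N).length = N := by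
  simp [digits]

theorem prepend_digits (x : ℕ → Fin n) (N : ℕ) :
    prepend (digits x N) (fun k => x (k + N)) = x := by
  funext k
  by_cases h : k < N
  · simp [prepend, digits, h]
  · simp only [prepend, length_digits, h, dite_false]
    congr 1; omega

theorem prepend_apply_of_lt {w : List (Fin n)} (ψ : ℕ → Fin n) {k : ℕ} (h : k < w.length) :
    prepend w ψ k = w[k] := by simp [prepend, h]

theorem prepend_apply_add (w : List (Fin n)) (ψ : ℕ → Fin n) (k : ℕ) :
    prepend w ψ (k + w.length) = ψ k := by simp [prepend]

theorem digits_prepend (w : List (Fin n)) (ψ : ℕ → Fin n) :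
    digits (prepend w ψ) w.length = w :=
  ((prepend_inj (length_digits _ _)).1 (prepend_digits (prepend w ψ) w.length)).1

theorem digits_add (x : ℕ → Fin n) (N M : ℕ) :
    digits x (N + M) = digits x N ++ digits (fun k => x (k + N)) M := by
  simp only [digits, List.ofFn_add]
  congr 2
  funext i
  simp [add_comm]

theorem digits_eq_iff {x y : ℕ → Fin n} {N : ℕ} :
    digits x N = digits y N ↔ ∀ k < N, x k = y k := by
  simp only [digits, List.ofFn_inj, funext_iff]
  exact ⟨fun h k hk => h ⟨k, hk⟩, fun h k => h k k.2⟩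

theorem mem_cone_iff {α : Prefix n q} {x : CantorSpace n q} :
    x ∈ cone α ↔ x.1 = α.1 ∧ digits x.2 α.2.length = α.2 := by
  constructor
  · rintro ⟨ψ, rfl⟩
    exact ⟨rfl, digits_prepend _ _⟩
  · rintro ⟨h1, h2⟩
    refine ⟨fun k => x.2 (k + α.2.length), Prod.ext h1.symm ?_⟩
    have := prepend_digits x.2 α.2.length
    rw [h2] at this
    exact this

theorem isOpen_cone (α : Prefix n q) : IsOpen (cone α) := by
  have : cone α = {x | x.1 = α.1} ∩ ⋂ i : Fin α.2.length, {x | x.2 i = α.2[i]} := by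
    ext x
    rw [mem_cone_iff]
    simp only [mem_inter_iff, mem_ofPred_eq, mem_iInter, and_congr_right_iff]
    intro _
    rw [List.ext_get_iff]
    simp [digits, Fin.forall_iff]
  rw [this]
  refine IsOpen.inter ?_ (isOpen_iInter_of_finite fun i => ?_)
  · exact (isOpen_discrete {α.1}).preimage continuous_fst
  · exact (isOpen_discrete {α.2.get i}).preimage
      (f := fun x : CantorSpace n q => x.2 i) ((continuous_apply (i : ℕ)).comp continuous_snd)

/-- The cone of all points that share the first `N` digits after the root with `x`. -/
def nbhd (x : CantorSpace n q) (N : ℕ) : Prefix n q := (x.1, digits x.2 N)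

theorem nbhd_append (x : CantorSpace n q) (N : ℕ) :
    (nbhd x N).append (fun k => x.2 (k + N)) = x :=
  Prod.ext rfl (prepend_digits _ _)

theorem mem_cone_nbhd_iff {x y : CantorSpace n q} {N : ℕ} :
    y ∈ cone (nbhd x N) ↔ nbhd y N = nbhd x N := by
  rw [mem_cone_iff, Prod.ext_iff]
  simp [nbhd]

/-! ### Maps that are prefix replacements near a point. -/

/-- Near `x` the map `f` is a prefix replacement. -/
def LocalAt (f : CantorSpace n q → CantorSpace n r) (x : CantorSpace n q) : Prop :=
  ∃ (α : Prefix n q) (β : Prefix n r), x ∈ cone α ∧ ActsAsPrefixReplacement f α β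

theorem ActsAsPrefixReplacement.extend {f : CantorSpace n q → CantorSpace n r}
    {α : Prefix n q} {β : Prefix n r} (h : ActsAsPrefixReplacement f α β) (u : List (Fin n)) :
    ActsAsPrefixReplacement f (α.1, α.2 ++ u) (β.1, β.2 ++ u) := fun ψ => by
  rw [append_append, append_append]; exact h _

/-- A locally acting map acts on the cones of sufficiently long prefixes. -/
theorem LocalAt.exists_nbhd {f : CantorSpace n q → CantorSpace n r} {x : CantorSpace n q}
    (h : LocalAt f x) : ∃ N, ∀ M, N ≤ M → ∃ β, ActsAsPrefixReplacement f (nbhd x M) β := by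
  obtain ⟨α, β, hx, hf⟩ := h
  refine ⟨α.2.length, fun M hM => ?_⟩
  obtain ⟨h1, h2⟩ := mem_cone_iff.1 hx
  obtain ⟨K, rfl⟩ := Nat.exists_eq_add_of_le hM
  have := hf.extend (digits (fun k => x.2 (k + α.2.length)) K)
  rw [nbhd, digits_add, h1, h2]
  exact ⟨_, this⟩

/-- The target prefix of `f` and the source prefix of `g` share a point, so one extends the other,
and lengthening the shorter makes them agree. The pointwise form is needed for bijections that are
not Thompson-like everywhere. -/
theorem LocalAt.comp {p : ℕ} {g : CantorSpace n q → CantorSpace n r}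
    {f : CantorSpace n p → CantorSpace n q} {x : CantorSpace n p} (hg : LocalAt g (f x))
    (hf : LocalAt f x) : LocalAt (g ∘ f) x := by
  obtain ⟨⟨a, α⟩, ⟨b, β⟩, ⟨ψ, rfl⟩, hfα⟩ := hf
  obtain ⟨⟨c, γ⟩, ⟨d, δ⟩, ⟨φ, hφ⟩, hgγ⟩ := hg
  rw [hfα] at hφ
  obtain ⟨hcb, hw⟩ := Prod.ext_iff.mp hφ
  simp only [Prefix.append] at hcb hw
  subst hcb
  rcases le_total γ.length β.length with hl | hl
  · obtain ⟨u, rfl, -⟩ := exists_suffix_of_prepend_eq hw hl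
    refine ⟨(a, α), (d, δ ++ u), ⟨ψ, rfl⟩, fun ξ => ?_⟩
    rw [Function.comp_apply, hfα, append_append, hgγ, append_append]
  · obtain ⟨u, rfl, hu⟩ := exists_suffix_of_prepend_eq hw.symm hl
    refine ⟨(a, α ++ u), (d, δ), ⟨φ, ?_⟩, fun ξ => ?_⟩
    · rw [append_append, hu]
    · rw [Function.comp_apply, append_append, hfα, ← append_append, hgγ]

theorem continuous_prepend (w : List (Fin n)) : Continuous (prepend w) := by
  refine continuous_pi fun k => ?_
  unfold prepend
  split_ifs
  · exact continuous_const
  · exact continuous_apply _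

theorem LocalAt.continuousAt {f : CantorSpace n q → CantorSpace n r} {x : CantorSpace n q}
    (h : LocalAt f x) : ContinuousAt f x := by
  obtain ⟨α, β, hx, hf⟩ := h
  have hg : Continuous fun y : CantorSpace n q => β.append (fun k => y.2 (k + α.2.length)) := by
    refine continuous_const.prodMk ((continuous_prepend _).comp ?_)
    exact continuous_pi fun k => (continuous_apply _).comp continuous_snd
  refine hg.continuousAt.congr ?_
  filter_upwards [(isOpen_cone α).mem_nhds hx] with y hy
  obtain ⟨ψ, rfl⟩ := hy
  rw [hf]
  congr 1
  funext k
  exact prepend_apply_add _ _ _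

theorem LocalAt.symm {e : CantorSpace n q ≃ CantorSpace n r} {y : CantorSpace n r}
    (h : LocalAt e (e.symm y)) : LocalAt e.symm y := by
  obtain ⟨α, β, ⟨ψ, hψ⟩, h⟩ := h
  refine ⟨β, α, ⟨ψ, ?_⟩, fun ξ => ?_⟩
  · rw [← h, hψ, e.apply_symm_apply]
  · rw [← h, e.symm_apply_apply]

/-- A Thompson-like permutation of the Cantor space as an element of `V`. -/
def V.mk (e : Equiv.Perm (CantorSpace n q)) (h : IsThompsonLike e) : V n q :=
  ⟨{ e with
      continuous_toFun := continuous_iff_continuousAt.2 fun x => LocalAt.continuousAt (h x)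
      continuous_invFun := continuous_iff_continuousAt.2 fun _ =>
        (LocalAt.symm (h _)).continuousAt }, h⟩

@[simp] theorem V.mk_apply (e : Equiv.Perm (CantorSpace n q)) (h : IsThompsonLike e)
    (x : CantorSpace n q) : (V.mk e h).1 x = e x := rfl

theorem V.ext_apply {f g : V n q} (h : ∀ x, f.1 x = g.1 x) : f = g :=
  Subtype.ext (Homeomorph.ext h)

@[simp] theorem V.mul_apply (f g : V n q) (x : CantorSpace n q) : (f * g).1 x = f.1 (g.1 x) := rfl

/-- The map `(i, ψ) ↦ aᵢψ` attached to a family of prefixes. -/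
def chart {I : Type*} (a : I → Prefix n q) (z : I × (ℕ → Fin n)) : CantorSpace n q :=
  (a z.1).append z.2

theorem localAt_of_chart {I : Type*} {a : I → Prefix n q} {b : I → Prefix n r}
    {f : CantorSpace n q → CantorSpace n r} (h : ∀ i ψ, f ((a i).append ψ) = (b i).append ψ)
    {x : CantorSpace n q} (hx : x ∈ range (chart a)) : LocalAt f x := by
  obtain ⟨⟨i, ψ⟩, rfl⟩ := hx
  exact ⟨a i, b i, ⟨ψ, rfl⟩, h i⟩

/-! ### Partitions into cones, and generation of V by torsion. -/

/-- The subgroup generated by the elements of finite order. -/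
def torsionClosure (G : Type*) [Group G] : Subgroup G := Subgroup.closure {g | IsOfFinOrder g}

theorem torsionClosure_map_le {G H : Type*} [Group G] [Group H] (φ : G →* H) :
    (torsionClosure G).map φ ≤ torsionClosure H := by
  rw [torsionClosure, MonoidHom.map_closure]
  refine Subgroup.closure_mono ?_
  rintro _ ⟨g, hg, rfl⟩
  exact φ.isOfFinOrder hg

/-- The cones of the prefixes `a i` partition the Cantor space. -/
def IsChart {I : Type*} (a : I → Prefix n q) : Prop := Bijective (chart a)

section
variable {I : Type*} {a b : I → Prefix n q}

theorem IsChart.eq_of_append_eq (ha : IsChart a) {i j : I} {φ ψ : ℕ → Fin n}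
    (h : (a i).append φ = (a j).append ψ) : i = j :=
  congrArg Prod.fst (ha.1 (a₁ := (i, φ)) (a₂ := (j, ψ)) h)

theorem IsChart.exists_append_eq (ha : IsChart a) (x : CantorSpace n q) :
    ∃ i ψ, (a i).append ψ = x := by
  obtain ⟨z, hz⟩ := ha.2 x
  exact ⟨z.1, z.2, hz⟩

theorem IsChart.surjective_fst [NeZero n] (ha : IsChart a) : Surjective fun i => (a i).1 :=
  fun s => by
    obtain ⟨i, ψ, h⟩ := ha.exists_append_eq (s, fun _ => 0)
    exact ⟨i, congrArg Prod.fst h⟩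

theorem IsChart.card_ge [NeZero n] [Finite I] (ha : IsChart a) : q ≤ Nat.card I := by
  simpa using Nat.card_le_card_of_surjective _ ha.surjective_fst

/-- A partition into cones that is not the trivial one contains all the children of some
vertex. -/
theorem IsChart.exists_caret [NeZero n] [Finite I] (ha : IsChart a) (h : ∃ i, (a i).2 ≠ []) :
    ∃ (γ : Prefix n q) (c : Fin n → I), ∀ j, a (c j) = (γ.1, γ.2 ++ [j]) := by
  obtain ⟨i₁, hi₁⟩ := h
  have : Nonempty I := ⟨i₁⟩
  -- All siblings of a deepest cone belong to the partition.
  obtain ⟨i, hi⟩ := Finite.exists_max fun i => (a i).2.length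
  have hne : (a i).2 ≠ [] := by
    intro h0
    have := hi i₁
    simp only [h0, List.length_nil, Nat.le_zero, List.length_eq_zero_iff] at this
    exact hi₁ this
  obtain ⟨v, j₀, hv⟩ : ∃ v j, (a i).2 = v ++ [j] :=
    ⟨_, _, (List.dropLast_append_getLast hne).symm⟩
  suffices H : ∀ j, ∃ i', a i' = ((a i).1, v ++ [j]) by
    choose c hc using H
    exact ⟨((a i).1, v), c, hc⟩
  intro j
  obtain ⟨i', φ, hφ⟩ := ha.exists_append_eq (Prefix.append ((a i).1, v ++ [j]) fun _ => 0)
  obtain ⟨h1, h2⟩ := Prod.ext_iff.1 hφ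
  simp only [Prefix.append] at h1 h2
  have hl := hi i'
  simp only [hv, List.length_append, List.length_singleton] at hl
  obtain ⟨u, hu, -⟩ := exists_suffix_of_prepend_eq h2 (by simpa using hl)
  rcases List.eq_nil_or_concat u with rfl | ⟨u', j', rfl⟩
  · exact ⟨i', Prod.ext h1 (by simpa using hu.symm)⟩
  -- Otherwise the cone meeting the sibling belongs to a prefix of `v`, so it contains the cone of
  -- `i`; disjointness makes the two equal, against their lengths.
  · exfalso
    simp only [List.concat_eq_append, ← List.append_assoc] at hu
    obtain ⟨hv', -⟩ := List.append_inj' hu rfl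
    have : i' = i := by
      apply ha.eq_of_append_eq (φ := prepend (u' ++ [j₀]) fun _ => 0) (ψ := fun _ => 0)
      rw [← append_append, h1]
      change _ = Prefix.append ((a i).1, (a i).2) _
      rw [hv]
      rw [hv', List.append_assoc]
    subst this
    have := congrArg List.length hv'
    rw [hv] at this
    simp at this

/-- Merging the children of `γ` in a partition into cones. -/
def mergeChart (a : I → Prefix n q) (c : Fin n → I) (γ : Prefix n q) :
    Option {i // i ∉ range c} → Prefix n q
  | none => γ
  | some i => a i

theorem caret_injective {γ : Prefix n q} {c : Fin n → I}
    (hc : ∀ j, a (c j) = (γ.1, γ.2 ++ [j])) : Injective c := fun i j h => by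
  have := (hc i).symm.trans ((congrArg a h).trans (hc j))
  simpa using this

theorem append_caret {γ : Prefix n q} {c : Fin n → I}
    (hc : ∀ j, a (c j) = (γ.1, γ.2 ++ [j])) (ψ : ℕ → Fin n) :
    γ.append ψ = (a (c (ψ 0))).append fun k => ψ (k + 1) := by
  rw [hc, append_append]
  congr 1
  simpa [digits] using (prepend_digits ψ 1).symm

theorem IsChart.merge (ha : IsChart a) {γ : Prefix n q} {c : Fin n → I}
    (hc : ∀ j, a (c j) = (γ.1, γ.2 ++ [j])) : IsChart (mergeChart a c γ) := by
  constructor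
  · rintro ⟨_ | i, φ⟩ ⟨_ | j, ψ⟩ h
    · exact congrArg _ (append_injective γ h)
    · change γ.append φ = (a j).append ψ at h
      rw [append_caret hc] at h
      exact absurd ⟨_, ha.eq_of_append_eq h⟩ j.2
    · change (a i).append φ = γ.append ψ at h
      rw [append_caret hc] at h
      exact absurd ⟨_, (ha.eq_of_append_eq h).symm⟩ i.2
    · have := ha.1 (a₁ := (i.1, φ)) (a₂ := (j.1, ψ)) h
      simp only [Prod.mk.injEq] at this ⊢
      simp [Subtype.ext_iff, this.1, this.2]
  · intro x
    obtain ⟨i, ψ, rfl⟩ := ha.exists_append_eq x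
    by_cases hi : i ∈ range c
    · obtain ⟨j, rfl⟩ := hi
      refine ⟨(none, prepend [j] ψ), ?_⟩
      change γ.append _ = _
      rw [append_caret hc]
      congr 1
    · exact ⟨(some ⟨i, hi⟩, ψ), rfl⟩

theorem card_merge [Finite I] {c : Fin n → I} (hc : Injective c) :
    Nat.card (Option {i // i ∉ range c}) + n = Nat.card I + 1 := by
  classical
  have := Fintype.ofFinite I
  have h1 : Nat.card {i // i ∉ range c} = Nat.card I - n := by
    rw [Nat.card_eq_fintype_card, Fintype.card_subtype_compl, Nat.card_eq_fintype_card]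
    congr 1
    exact (Set.card_range_of_injective hc).trans (Fintype.card_fin n)
  have h2 : n ≤ Nat.card I := by simpa using Nat.card_le_card_of_injective c hc
  rw [Finite.card_option, h1]
  omega

/-- Each root needs a cone, so q is the least possible number. A nontrivial partition has a caret,
and merging it removes n − 1 ≥ 1 cones, so it had more than q. -/
theorem IsChart.forall_eq_nil_iff (hn : 2 ≤ n) [Finite I] (ha : IsChart a) :
    (∀ i, (a i).2 = []) ↔ Nat.card I = q := by
  have : NeZero n := ⟨by omega⟩
  constructor
  · intro h
    refine le_antisymm ?_ ha.card_ge
    have : Injective fun i => (a i).1 := fun i j hij => by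
      refine ha.eq_of_append_eq (φ := fun _ => 0) (ψ := fun _ => 0) ?_
      rw [show a i = a j from Prod.ext hij (by rw [h, h])]
    simpa using Nat.card_le_card_of_injective _ this
  · intro h
    by_contra! h'
    obtain ⟨γ, c, hc⟩ := ha.exists_caret h'
    have h1 := (ha.merge hc).card_ge
    have h2 := card_merge (caret_injective hc)
    omega

/-- The element of `V` permuting the cones of a partition. -/
noncomputable def permElement (ha : IsChart a) : Equiv.Perm I →* V n q :=
  let e : I × (ℕ → Fin n) ≃ CantorSpace n q := Equiv.ofBijective _ ha
  MonoidHom.mk' (fun σ => V.mk (e.symm.trans ((Equiv.prodCongr σ (Equiv.refl _)).trans e))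
    fun x => localAt_of_chart (a := a) (b := a ∘ σ) (fun i ψ => by
      rw [show (a i).append ψ = e (i, ψ) from rfl]
      simp only [Equiv.trans_apply, Equiv.symm_apply_apply]
      rfl) (ha.2 x)) fun σ τ => V.ext_apply fun x =>
      congrArg (fun z => e (Prod.map σ id z)) (e.symm_apply_apply (Prod.map τ id (e.symm x))).symm

theorem permElement_append (ha : IsChart a) (σ : Equiv.Perm I) (i : I) (ψ : ℕ → Fin n) :
    (permElement ha σ).1 ((a i).append ψ) = (a (σ i)).append ψ := by
  exact congrArg (fun z => chart a (Prod.map σ id z))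
    ((Equiv.ofBijective _ ha).symm_apply_apply (i, ψ))

theorem permElement_mem [Finite I] (ha : IsChart a) (σ : Equiv.Perm I) :
    permElement ha σ ∈ torsionClosure (V n q) :=
  Subgroup.subset_closure ((permElement ha).isOfFinOrder (isOfFinOrder_of_finite σ))

end

theorem exists_perm_extending {I : Type*} [Finite I] {m : ℕ} {c d : Fin m → I}
    (hc : Injective c) (hd : Injective d) : ∃ σ : Equiv.Perm I, ∀ j, σ (c j) = d j := by
  classical
  have := Fintype.ofFinite I
  let e : {x // x ∈ range c} ≃ {x // x ∈ range d} :=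
    (Equiv.ofInjective c hc).symm.trans (Equiv.ofInjective d hd)
  refine ⟨e.extendSubtype, fun j => ?_⟩
  rw [Equiv.extendSubtype_apply_of_mem _ _ (mem_range_self j)]
  have : (⟨c j, mem_range_self j⟩ : range c) = Equiv.ofInjective c hc j := rfl
  simp only [e, Equiv.trans_apply]
  erw [this, Equiv.symm_apply_apply]
  rfl

/-- Induction on the number of cones. Composing with a permutation of the target cones, which has
finite order, makes `f` carry a caret onto a caret; merging both leaves fewer cones. With q cones,
`f` just permutes the roots. -/
theorem mem_torsionClosure_of_charts (hn : 2 ≤ n) (m : ℕ) :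
    ∀ (I : Type) [Finite I], Nat.card I = m → ∀ a b : I → Prefix n q, IsChart a → IsChart b →
      ∀ f : V n q, (∀ i ψ, f.1 ((a i).append ψ) = (b i).append ψ) →
        f ∈ torsionClosure (V n q) := by
  have : NeZero n := ⟨by omega⟩
  induction m using Nat.strong_induction_on with
  | _ m ih =>
  intro I _ hm a b ha hb f hf
  by_cases hI : Nat.card I = q
  · have ha0 := (ha.forall_eq_nil_iff hn).2 hI
    have hb0 := (hb.forall_eq_nil_iff hn).2 hI
    have hinj : ∀ {d : I → Prefix n q}, IsChart d → (∀ i, (d i).2 = []) →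
        Bijective fun i => (d i).1 := fun {d} hd h => by
      refine ⟨fun i j hij => ?_, hd.surjective_fst⟩
      refine hd.eq_of_append_eq (φ := fun _ => 0) (ψ := fun _ => 0) ?_
      rw [show d i = d j from Prod.ext hij (by rw [h, h])]
    let ea := Equiv.ofBijective _ (hinj ha ha0)
    let eb := Equiv.ofBijective _ (hinj hb hb0)
    convert permElement_mem ha (eb.trans ea.symm) using 1
    refine V.ext_apply fun x => ?_
    obtain ⟨i, ψ, rfl⟩ := ha.exists_append_eq x
    rw [permElement_append, hf]
    congr 1
    refine Prod.ext ?_ (by rw [ha0, hb0])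
    exact (ea.apply_symm_apply (eb i)).symm
  · have ha0 := (ha.forall_eq_nil_iff hn).not.2 hI
    have hb0 := (hb.forall_eq_nil_iff hn).not.2 hI
    push Not at ha0 hb0
    obtain ⟨γ, c, hc⟩ := ha.exists_caret ha0
    obtain ⟨δ, d, hd⟩ := hb.exists_caret hb0
    obtain ⟨σ, hσ⟩ := exists_perm_extending (caret_injective hc) (caret_injective hd)
    have hcard := card_merge (caret_injective hc)
    have hbσ : IsChart (b ∘ σ) := by
      have : chart (b ∘ σ) = chart b ∘ Equiv.prodCongr σ (Equiv.refl _) := rfl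
      rw [IsChart, this]
      exact hb.comp (Equiv.bijective _)
    have hd' : ∀ j, (b ∘ σ) (c j) = (δ.1, δ.2 ++ [j]) := fun j => by
      rw [comp_apply, hσ, hd]
    have hg : ∀ i ψ, (permElement hb σ * f).1 ((a i).append ψ) = ((b ∘ σ) i).append ψ := by
      intro i ψ
      rw [V.mul_apply, hf, permElement_append]
      rfl
    have := ih _ (by omega) _ rfl _ _ (ha.merge hc) (hbσ.merge hd') (permElement hb σ * f) (by
      rintro (_ | i) ψ
      · change (permElement hb σ * f).1 (γ.append ψ) = δ.append ψ
        rw [append_caret hc, append_caret hd', hg]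
      · exact hg i.1 ψ)
    exact (Subgroup.mul_mem_cancel_left _ (permElement_mem hb σ)).1 this

/-- Compactness makes the local depths uniform. -/
theorem exists_depth (f : V n q) : ∃ N, ∀ x, ∃ β, ActsAsPrefixReplacement f.1 (nbhd x N) β := by
  choose M hM using fun x => LocalAt.exists_nbhd (f.2 x)
  obtain ⟨t, -, ht⟩ := isCompact_univ.elim_nhds_subcover
    (fun x : CantorSpace n q => cone (nbhd x (M x)))
    (fun x _ => (isOpen_cone _).mem_nhds ⟨_, nbhd_append x (M x)⟩)
  refine ⟨t.sup M, fun x => ?_⟩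
  obtain ⟨y, hy, hxy⟩ := mem_iUnion₂.1 (ht (mem_univ x))
  obtain ⟨β, hβ⟩ := hM y (M y) le_rfl
  rw [mem_cone_nbhd_iff] at hxy
  obtain ⟨K, hK⟩ := Nat.exists_eq_add_of_le (Finset.le_sup (f := M) hy)
  have := hβ.extend (digits (fun k => x.2 (k + M y)) K)
  rw [← hxy] at this
  rw [hK, nbhd, digits_add]
  exact ⟨_, this⟩

/-- The prefix with root `v.1` and the word `v.2`. -/
def levelPrefix {N : ℕ} (v : Fin q × (Fin N → Fin n)) : Prefix n q := (v.1, List.ofFn v.2)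

theorem levelPrefix_injective {N : ℕ} : Injective (levelPrefix (n := n) (q := q) (N := N)) := by
  rintro ⟨s, v⟩ ⟨t, w⟩ h
  simpa [levelPrefix] using h

theorem chart_levelPrefix_injective {N : ℕ} :
    Injective (chart (levelPrefix (n := n) (q := q) (N := N))) := by
  rintro ⟨v, φ⟩ ⟨w, ψ⟩ h
  obtain ⟨h1, h2⟩ := Prod.ext_iff.1 h
  obtain ⟨h2, h3⟩ := (prepend_inj (by simp [levelPrefix])).1 h2
  exact Prod.ext (levelPrefix_injective (Prod.ext h1 h2)) h3

theorem torsionClosure_V (hn : 2 ≤ n) : torsionClosure (V n q) = ⊤ := by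
  have : NeZero n := ⟨by omega⟩
  rw [eq_top_iff]
  intro f _
  obtain ⟨N, hN⟩ := exists_depth f
  have ha : IsChart (levelPrefix (n := n) (q := q) (N := N)) :=
    ⟨chart_levelPrefix_injective, fun x => ⟨(⟨x.1, fun i => x.2 i⟩, _), nbhd_append x N⟩⟩
  have hb : ∀ v, ∃ β, ActsAsPrefixReplacement f.1 (levelPrefix (n := n) (q := q) (N := N) v) β := by
    intro v
    obtain ⟨β, hβ⟩ := hN ((levelPrefix v).append fun _ => 0)
    refine ⟨β, ?_⟩
    convert hβ using 1
    refine Prod.ext rfl ?_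
    have := digits_prepend (levelPrefix v).2 fun _ => 0
    simp only [levelPrefix, List.length_ofFn] at this
    exact this.symm
  choose b hb using hb
  refine mem_torsionClosure_of_charts hn _ _ rfl _ b ha ?_ f hb
  have : chart b = f.1 ∘ chart levelPrefix := funext fun z => (hb z.1 z.2).symm
  rw [IsChart, this]
  exact f.1.bijective.comp ha

/-! ### Germs at fixed points and their degrees. -/

theorem ActsAsPrefixReplacement.length_eq (hn : 2 ≤ n) {f : CantorSpace n q → CantorSpace n r}
    {α : Prefix n q} {β γ : Prefix n r} (hβ : ActsAsPrefixReplacement f α β)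
    (hγ : ActsAsPrefixReplacement f α γ) : β.2.length = γ.2.length := by
  have : Nontrivial (Fin n) := Fin.nontrivial_iff_two_le.2 hn
  wlog hl : β.2.length ≤ γ.2.length generalizing β γ
  · exact (this hγ hβ (by omega)).symm
  have key : ∀ ψ, prepend β.2 ψ = prepend γ.2 ψ := fun ψ =>
    congrArg Prod.snd ((hβ ψ).symm.trans (hγ ψ))
  have hd : Nonempty (Fin n) := inferInstance
  obtain ⟨u, hu, -⟩ := exists_suffix_of_prepend_eq (key fun _ => hd.some) hl
  rcases u with _ | ⟨d, u⟩
  · simp [hu]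
  · obtain ⟨c, hc⟩ := exists_ne d
    have := key fun _ => c
    rw [hu, prepend_append] at this
    have := congrFun (prepend_injective _ this) 0
    simp at this
    exact absurd this hc

theorem ActsAsPrefixReplacement.eq_nbhd {f : CantorSpace n q → CantorSpace n q}
    {p : CantorSpace n q} (hp : f p = p) {M : ℕ} {β : Prefix n q}
    (h : ActsAsPrefixReplacement f (nbhd p M) β) : β = nbhd p β.2.length := by
  have := h fun k => p.2 (k + M)
  rw [nbhd_append, hp] at this
  obtain ⟨h1, h2⟩ := mem_cone_iff.1 ⟨_, this.symm⟩
  exact Prod.ext h1.symm h2.symm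

/-- The map `f` acts near `p` by replacing the first `M` digits of `p` with its first `K`
digits. -/
def GermAt (f : CantorSpace n q → CantorSpace n q) (p : CantorSpace n q) (M K : ℕ) : Prop :=
  ActsAsPrefixReplacement f (nbhd p M) (nbhd p K)

theorem GermAt.add {f : CantorSpace n q → CantorSpace n q} {p : CantorSpace n q} {M K : ℕ}
    (h : GermAt f p M K) (hp : f p = p) (j : ℕ) : GermAt f p (M + j) (K + j) := by
  have := h.extend (digits (fun k => p.2 (k + M)) j)
  have h1 : ((nbhd p M).1, (nbhd p M).2 ++ digits (fun k => p.2 (k + M)) j) = nbhd p (M + j) := by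
    simp [nbhd, digits_add]
  rw [h1] at this
  have h2 := this.eq_nbhd hp
  simp only [nbhd, List.length_append, length_digits] at h2
  simp only [nbhd, h2] at this
  exact this

theorem LocalAt.exists_germ {f : CantorSpace n q → CantorSpace n q} {p : CantorSpace n q}
    (h : LocalAt f p) (hp : f p = p) : ∃ N, ∀ M, N ≤ M → ∃ K, GermAt f p M K := by
  obtain ⟨N, hN⟩ := h.exists_nbhd
  refine ⟨N, fun M hM => ?_⟩
  obtain ⟨β, hβ⟩ := hN M hM
  rw [hβ.eq_nbhd hp] at hβ
  exact ⟨_, hβ⟩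

theorem GermAt.unique (hn : 2 ≤ n) {f : CantorSpace n q → CantorSpace n q} {p : CantorSpace n q}
    {M K M' K' : ℕ} (h : GermAt f p M K) (h' : GermAt f p M' K') (hp : f p = p) :
    K + M' = K' + M := by
  have h1 := h.add hp M'
  have h2 := h'.add hp M
  rw [add_comm M' M] at h2
  simpa [nbhd] using ActsAsPrefixReplacement.length_eq hn h1 h2

theorem GermAt.mul {f g : CantorSpace n q → CantorSpace n q} {p : CantorSpace n q}
    {M K L : ℕ} (hf : GermAt f p K L) (hg : GermAt g p M K) : GermAt (f ∘ g) p M L :=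
  fun ψ => by rw [comp_apply, hg, hf]

theorem exists_germ {S : Set (CantorSpace n q)} (g : Fix S) (p : S) :
    ∃ N, ∀ M, N ≤ M → ∃ K, GermAt g.1.1 p M K :=
  LocalAt.exists_germ (g.1.2 p) (g.2 p p.2)

theorem exists_degree {S : Set (CantorSpace n q)} (g : Fix S) (p : S) :
    ∃ z : ℤ, ∃ M K : ℕ, GermAt g.1.1 p M K ∧ z = K - M := by
  obtain ⟨N, hN⟩ := exists_germ g p
  obtain ⟨K, hK⟩ := hN N le_rfl
  exact ⟨_, N, K, hK, rfl⟩

/-- The number of digits by which `g` lengthens prefixes near its fixed point `p`. -/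
noncomputable def degree {S : Set (CantorSpace n q)} (g : Fix S) (p : S) : ℤ :=
  (exists_degree g p).choose

theorem degree_eq (hn : 2 ≤ n) {S : Set (CantorSpace n q)} {g : Fix S} {p : S} {M K : ℕ}
    (h : GermAt g.1.1 p M K) : degree g p = K - M := by
  obtain ⟨M', K', h', hz⟩ := (exists_degree g p).choose_spec
  rw [degree, hz]
  have := h.unique hn h' (g.2 p p.2)
  omega

/-- The homomorphism recording the germs of an element of `Fix S` at the points of `S`. -/
noncomputable def germHom (hn : 2 ≤ n) (S : Set (CantorSpace n q)) :
    Fix S →* Multiplicative (S → ℤ) :=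
  MonoidHom.mk' (fun g => Multiplicative.ofAdd (degree g)) fun f g => by
    rw [← ofAdd_add]
    congr 1
    funext p
    obtain ⟨N, hN⟩ := exists_germ f p
    obtain ⟨N', hN'⟩ := exists_germ g p
    obtain ⟨K, hK⟩ := hN' N' le_rfl
    -- Lengthening by `N` makes the target depth of `g` large enough for the germ of `f`.
    have hg := GermAt.add hK (g.2 p p.2) N
    obtain ⟨L, hL⟩ := hN (K + N) (by omega)
    have hfg : GermAt (f * g).1.1 p (N' + N) L := hL.mul hg
    rw [Pi.add_apply, degree_eq hn hg, degree_eq hn hL, degree_eq hn hfg]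
    push_cast
    ring

/-- Degree 0 means equal source and target prefixes, hence the identity on a cone; finiteness of `S`
gives a common depth. -/
theorem eq_self_of_mem_ker (hn : 2 ≤ n) {S : Set (CantorSpace n q)} (hS : S.Finite) {g : Fix S}
    (hg : g ∈ (germHom hn S).ker) :
    ∃ N, ∀ p ∈ S, ∀ x ∈ cone (nbhd p N), g.1.1 x = x := by
  have H : ∀ p : S, ∃ N, GermAt g.1.1 p N N := fun p => by
    obtain ⟨N, hN⟩ := exists_germ g p
    obtain ⟨K, hK⟩ := hN N le_rfl
    have h0 : degree g p = 0 := congrFun (congrArg Multiplicative.toAdd hg) p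
    rw [degree_eq hn hK] at h0
    obtain rfl : K = N := by omega
    exact ⟨_, hK⟩
  choose N hN using H
  have := hS.fintype
  refine ⟨Finset.univ.sup N, fun p hp x hx => ?_⟩
  obtain ⟨j, hj⟩ := Nat.exists_eq_add_of_le (Finset.le_sup (f := N) (Finset.mem_univ ⟨p, hp⟩))
  have := (hN ⟨p, hp⟩).add (g.2 p hp) j
  rw [← hj] at this
  obtain ⟨ψ, rfl⟩ := hx
  exact this ψ

/-! ### The kernel of the germ homomorphism. -/

/-- Elements of `V n t` act on the image of the chart of a family of `t` prefixes, and trivially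
off it. -/
noncomputable def extendHom {t : ℕ} (ρ : Fin t → Prefix n q) (hρ : Injective (chart ρ))
    (hc : ∀ x ∉ range (chart ρ), ∃ N, Disjoint (cone (nbhd x N)) (range (chart ρ))) :
    V n t →* V n q :=
  MonoidHom.mk' (fun f => V.mk (Equiv.Perm.viaEmbedding f.1.toEquiv ⟨chart ρ, hρ⟩) fun x => by
    by_cases hx : x ∈ range (chart ρ)
    · obtain ⟨y, rfl⟩ := hx
      obtain ⟨α, β, ⟨ψ, rfl⟩, h⟩ := f.2 y
      have key : ∀ (γ : Prefix n t) (φ : ℕ → Fin n), chart ρ (γ.append φ) =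
          Prefix.append ((ρ γ.1).1, (ρ γ.1).2 ++ γ.2) φ := fun γ φ => by
        rw [append_append]; rfl
      refine ⟨((ρ α.1).1, (ρ α.1).2 ++ α.2), ((ρ β.1).1, (ρ β.1).2 ++ β.2),
        ⟨ψ, (key _ _).symm⟩, fun φ => ?_⟩
      rw [← key, ← key, ← h φ]
      exact Equiv.Perm.viaEmbedding_apply _ ⟨chart ρ, hρ⟩ _
    · obtain ⟨N, hN⟩ := hc x hx
      refine ⟨nbhd x N, nbhd x N, ⟨_, nbhd_append x N⟩, fun φ => ?_⟩
      exact Equiv.Perm.viaEmbedding_apply_of_notMem _ ⟨chart ρ, hρ⟩ _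
        (Set.disjoint_left.1 hN ⟨φ, rfl⟩))
    fun f g => V.ext_apply fun x =>
      DFunLike.congr_fun (map_mul (Equiv.Perm.viaEmbeddingHom ⟨chart ρ, hρ⟩)
        f.1.toEquiv g.1.toEquiv) x

theorem extendHom_apply_chart {t : ℕ} {ρ : Fin t → Prefix n q} (hρ : Injective (chart ρ))
    (hc) (f : V n t) (y : CantorSpace n t) :
    (extendHom ρ hρ hc f).1 (chart ρ y) = chart ρ (f.1 y) :=
  Equiv.Perm.viaEmbedding_apply f.1.toEquiv ⟨chart ρ, hρ⟩ y

theorem extendHom_apply_of_notMem {t : ℕ} {ρ : Fin t → Prefix n q} (hρ : Injective (chart ρ))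
    (hc) (f : V n t) {x : CantorSpace n q} (hx : x ∉ range (chart ρ)) :
    (extendHom ρ hρ hc f).1 x = x :=
  Equiv.Perm.viaEmbedding_apply_of_notMem f.1.toEquiv ⟨chart ρ, hρ⟩ _ hx

/-- Being trivial off the image of the chart, `g` preserves that image, so it can be pulled back
along the chart, whose inverse is locally a prefix replacement there. -/
theorem exists_extendHom_eq {t : ℕ} {ρ : Fin t → Prefix n q} (hρ : Injective (chart ρ))
    (hc) (g : V n q) (hg : ∀ x ∉ range (chart ρ), g.1 x = x) :
    ∃ f, extendHom ρ hρ hc f = g := by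
  have hmem : ∀ x, g.1 x ∈ range (chart ρ) ↔ x ∈ range (chart ρ) := by
    intro x
    constructor
    · intro h
      by_contra h'
      exact h' (hg x h' ▸ h)
    · intro h
      by_contra h'
      exact h' ((g.1.injective (hg _ h')).symm ▸ h)
  let e := Equiv.ofInjective _ hρ
  let f₀ : Equiv.Perm (CantorSpace n t) :=
    e.permCongr.symm (Equiv.Perm.subtypePerm g.1.toEquiv hmem)
  have hf₀ : ∀ y, chart ρ (f₀ y) = g.1 (chart ρ y) := fun y =>
    congrArg Subtype.val (e.apply_symm_apply ⟨g.1 (chart ρ y), (hmem _).2 ⟨y, rfl⟩⟩)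
  have hloc : IsThompsonLike f₀ := by
    intro y
    have : Nonempty (CantorSpace n t) := ⟨y⟩
    have hinv := leftInverse_invFun hρ
    have heq : (f₀ : CantorSpace n t → _) = invFun (chart ρ) ∘ (g.1 ∘ chart ρ) := funext fun y => by
      rw [comp_apply, comp_apply, ← hf₀, hinv]
    rw [heq]
    refine LocalAt.comp ?_ (LocalAt.comp (g.2 _) ?_)
    · refine localAt_of_chart (a := ρ) (b := fun i => (i, [])) (fun i ψ => ?_)
        ((hmem _).2 ⟨y, rfl⟩)
      exact (hinv (i, ψ)).trans (Prod.ext rfl (prepend_nil ψ).symm)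
    · refine localAt_of_chart (a := fun i => (i, [])) (b := ρ) (fun i ψ => ?_)
        ⟨y, Prod.ext rfl (prepend_nil _)⟩
      change (ρ i).append (prepend [] ψ) = _
      rw [prepend_nil]
  refine ⟨V.mk f₀ hloc, V.ext_apply fun x => ?_⟩
  by_cases hx : x ∈ range (chart ρ)
  · obtain ⟨y, rfl⟩ := hx
    rw [extendHom_apply_chart, V.mk_apply, hf₀]
  · rw [extendHom_apply_of_notMem _ _ _ hx, hg x hx]

/-- The words of length `N` that are not prefixes of points of `S`. -/
abbrev OffLevel (S : Set (CantorSpace n q)) (N : ℕ) : Type :=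
  {v : Fin q × (Fin N → Fin n) // levelPrefix v ∉ (fun p => nbhd p N) '' S}

theorem mem_range_chart_offLevel {S : Set (CantorSpace n q)} {N : ℕ} {x : CantorSpace n q} :
    x ∈ range (chart fun v : OffLevel S N => levelPrefix v.1) ↔
      ∀ p ∈ S, x ∉ cone (nbhd p N) := by
  constructor
  · rintro ⟨⟨v, ψ⟩, rfl⟩ p hp hx
    refine v.2 ⟨p, hp, ?_⟩
    rw [mem_cone_nbhd_iff] at hx
    refine hx.symm.trans (Prod.ext rfl ?_)
    have := digits_prepend (levelPrefix v.1).2 ψ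
    simp only [levelPrefix, List.length_ofFn] at this
    exact this
  · intro h
    refine ⟨(⟨(x.1, fun i => x.2 i), ?_⟩, _), nbhd_append x N⟩
    rintro ⟨p, hp, hpx⟩
    exact h p hp (mem_cone_nbhd_iff.2 hpx.symm)

theorem chart_offLevel_injective {S : Set (CantorSpace n q)} {N : ℕ} :
    Injective (chart fun v : OffLevel S N => levelPrefix v.1) := by
  rintro ⟨v, φ⟩ ⟨w, ψ⟩ h
  have := chart_levelPrefix_injective (a₁ := (v.1, φ)) (a₂ := (w.1, ψ)) h
  simp only [Prod.mk.injEq] at this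
  exact Prod.ext (Subtype.ext this.1) this.2

/-- A kernel element is supported on the cones of some depth `N` that miss `S`. Their number t gives
a copy of V_{n,t} inside `Fix S`, and its torsion generators are torsion in `Fix S`. -/
theorem ker_germHom_le (hn : 2 ≤ n) {S : Set (CantorSpace n q)} (hS : S.Finite) :
    (germHom hn S).ker ≤ torsionClosure (Fix S) := by
  intro g hg
  obtain ⟨N, hN⟩ := eq_self_of_mem_ker hn hS hg
  let e := Finite.equivFin (OffLevel S N)
  let ρ : Fin (Nat.card (OffLevel S N)) → Prefix n q := fun i => levelPrefix (e.symm i).1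
  have hch : chart ρ = (chart fun v : OffLevel S N => levelPrefix v.1) ∘
      Equiv.prodCongr e.symm (Equiv.refl _) := rfl
  have hρ : Injective (chart ρ) := by
    rw [hch]
    exact chart_offLevel_injective.comp (Equiv.injective _)
  have hrange : ∀ x, x ∈ range (chart ρ) ↔ ∀ p ∈ S, x ∉ cone (nbhd p N) := fun x => by
    rw [hch, (Equiv.surjective _).range_comp, mem_range_chart_offLevel]
  have hc : ∀ x ∉ range (chart ρ), ∃ N, Disjoint (cone (nbhd x N)) (range (chart ρ)) := by
    intro x hx
    rw [hrange] at hx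
    push Not at hx
    obtain ⟨p, hp, hx⟩ := hx
    refine ⟨N, Set.disjoint_left.2 fun y hy hy' => (hrange y).1 hy' p hp ?_⟩
    rwa [← mem_cone_nbhd_iff.1 hx]
  have hfix : ∀ f, extendHom ρ hρ hc f ∈ Fix S := fun f p hp =>
    extendHom_apply_of_notMem _ _ _ fun h => (hrange p).1 h p hp ⟨_, nbhd_append p N⟩
  obtain ⟨f, hf⟩ := exists_extendHom_eq hρ hc g.1 fun x hx => by
    rw [hrange] at hx
    push Not at hx
    obtain ⟨p, hp, hx⟩ := hx
    exact hN p hp x hx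
  apply torsionClosure_map_le ((extendHom ρ hρ hc).codRestrict (Fix S) hfix)
  rw [torsionClosure_V hn]
  exact ⟨f, trivial, Subtype.ext hf⟩

/-! ### The rank as a group invariant. -/

/-- Since ℤ^B is torsion-free, `ψ` kills `torsionClosure G` and with it the kernel of `φ`. It
therefore factors through `φ` and induces a surjection ℤ^A → ℤ^B. -/
theorem card_le_of_surjective {G A B : Type*} [Group G] [Fintype A] [Fintype B]
    (φ : G →* Multiplicative (A → ℤ)) (hφ : Surjective φ) (hk : φ.ker ≤ torsionClosure G)
    (ψ : G →* Multiplicative (B → ℤ)) (hψ : Surjective ψ) : Fintype.card B ≤ Fintype.card A := by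
  have h1 : torsionClosure G ≤ ψ.ker := by
    refine (Subgroup.closure_le _).2 fun g hg => ?_
    have h2 : IsOfFinOrder (ψ g) := ψ.isOfFinOrder hg
    obtain ⟨m, hm, h⟩ := isOfFinOrder_iff_pow_eq_one.1 h2
    have h3 : m • (Multiplicative.toAdd (ψ g)) = 0 := congrArg Multiplicative.toAdd h
    have h4 : Multiplicative.toAdd (ψ g) = 0 := (smul_eq_zero.1 h3).resolve_left hm.ne'
    exact h4
  let χ := φ.liftOfSurjective hφ ⟨ψ, hk.trans h1⟩
  have hχ : ∀ g, χ (φ g) = ψ g := fun g => MonoidHom.liftOfRightInverse_comp_apply _ _ _ _ g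
  let l : (A → ℤ) →+ (B → ℤ) := MonoidHom.toAdditive χ
  have hl : Surjective l.toIntLinearMap := fun y => by
    obtain ⟨g, hg⟩ := hψ (Multiplicative.ofAdd y)
    exact ⟨Multiplicative.toAdd (φ g), by
      change Multiplicative.toAdd (χ (φ g)) = y
      rw [hχ, hg]; rfl⟩
  simpa using LinearMap.finrank_le_finrank_of_surjective hl

theorem card_eq_of_mulEquiv {G H A B : Type*} [Group G] [Group H] [Fintype A] [Fintype B]
    (e : G ≃* H) (φ : G →* Multiplicative (A → ℤ)) (hφ : Surjective φ)
    (hk : φ.ker ≤ torsionClosure G) (ψ : H →* Multiplicative (B → ℤ)) (hψ : Surjective ψ)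
    (hk' : ψ.ker ≤ torsionClosure H) : Fintype.card A = Fintype.card B :=
  le_antisymm
    (card_le_of_surjective ψ hψ hk' (φ.comp e.symm.toMonoidHom) (hφ.comp e.symm.surjective))
    (card_le_of_surjective φ hφ hk (ψ.comp e.toMonoidHom) (hψ.comp e.surjective))

/-! ### Surjectivity of the germ homomorphism at zero sequences. -/

/-- The sequence without its first digit. -/
def tail (x : ℕ → Fin n) : ℕ → Fin n := fun k => x (k + 1)

@[simp] theorem tail_cons (d : Fin n) (x : ℕ → Fin n) : tail (prepend [d] x) = x := by
  funext k; simp [tail]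

theorem prepend_cons (d : Fin n) (w : List (Fin n)) (x : ℕ → Fin n) :
    prepend (d :: w) x = prepend [d] (prepend w x) := prepend_append [d] w x

theorem cons_tail (x : ℕ → Fin n) : prepend [x 0] (tail x) = x := by
  funext k
  rcases k with _ | k <;> simp [tail]

theorem exists_eq_cons (x : ℕ → Fin n) : ∃ d y, x = prepend [d] y := ⟨_, _, (cons_tail x).symm⟩

section
variable [NeZero n]

/-- A prefix replacement map that contracts towards the zero sequence. -/
def contract (o : Fin n) (x : ℕ → Fin n) : ℕ → Fin n :=
  -- The cone of 0 shrinks onto that of 00. The vacated cones 0e with e ≠ 0 are filled from oe, and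
  -- the cone of o0 stretches over that of o.
  if x 0 = 0 then prepend [0] x
  else if x 0 = o then
    (if tail x 0 = 0 then prepend [o] (tail (tail x)) else prepend [0] (tail x))
  else x

/-- The inverse of `contract`. -/
def expand (o : Fin n) (y : ℕ → Fin n) : ℕ → Fin n :=
  if y 0 = 0 then (if tail y 0 = 0 then tail y else prepend [o] (tail y))
  else if y 0 = o then prepend [o, 0] (tail y)
  else y

theorem expand_contract {o : Fin n} (ho : o ≠ 0) (x : ℕ → Fin n) :
    expand o (contract o x) = x := by
  obtain ⟨d, y, rfl⟩ := exists_eq_cons x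
  obtain ⟨e, z, rfl⟩ := exists_eq_cons y
  by_cases hd : d = 0
  · subst hd; simp [expand, contract]
  by_cases hdo : d = o
  · subst hdo
    by_cases he : e = 0
    · subst he; simp [expand, contract, ho, prepend_cons d [0]]
    · simp [expand, contract, ho, he]
  · simp [expand, contract, hd, hdo]

theorem contract_expand {o : Fin n} (ho : o ≠ 0) (x : ℕ → Fin n) :
    contract o (expand o x) = x := by
  obtain ⟨d, y, rfl⟩ := exists_eq_cons x
  obtain ⟨e, z, rfl⟩ := exists_eq_cons y
  by_cases hd : d = 0
  · subst hd
    by_cases he : e = 0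
    · subst he; simp [expand, contract]
    · simp [expand, contract, ho, he]
  by_cases hdo : d = o
  · subst hdo
    simp [expand, contract, ho, prepend_cons d [0]]
  · simp [expand, contract, hd, hdo]

/-- The permutation acting as `contract` below one root. -/
def contractPerm (i : Fin q) {o : Fin n} (ho : o ≠ 0) : Equiv.Perm (CantorSpace n q) where
  toFun x := (x.1, if x.1 = i then contract o x.2 else x.2)
  invFun x := (x.1, if x.1 = i then expand o x.2 else x.2)
  left_inv x := Prod.ext rfl (by dsimp only; split_ifs <;> simp [expand_contract ho])
  right_inv x := Prod.ext rfl (by dsimp only; split_ifs <;> simp [contract_expand ho])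

theorem contractPerm_acts_of_ne {i j : Fin q} (h : j ≠ i) {o : Fin n} (ho : o ≠ 0) :
    ActsAsPrefixReplacement (contractPerm i ho) (j, []) (j, []) := fun ψ => by
  simp [contractPerm, Prefix.append, h]

theorem contractPerm_acts_zero (i : Fin q) {o : Fin n} (ho : o ≠ 0) :
    ActsAsPrefixReplacement (contractPerm i ho) (i, [0]) (i, [0, 0]) := fun ψ => by
  simp [contractPerm, Prefix.append, contract, prepend_cons 0 [0]]

theorem contractPerm_isThompsonLike (i : Fin q) {o : Fin n} (ho : o ≠ 0) :
    IsThompsonLike (contractPerm i ho) := by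
  rintro ⟨j, x⟩
  by_cases hj : j = i
  · subst hj
    obtain ⟨d, y, rfl⟩ := exists_eq_cons x
    obtain ⟨e, z, rfl⟩ := exists_eq_cons y
    by_cases hd : d = 0
    · subst hd
      exact ⟨_, _, ⟨_, rfl⟩, contractPerm_acts_zero j ho⟩
    by_cases hdo : d = o
    · subst hdo
      by_cases he : e = 0
      · subst he
        refine ⟨(j, [d, 0]), (j, [d]), ⟨z, Prod.ext rfl (prepend_cons _ _ _)⟩, fun ψ => ?_⟩
        simp [contractPerm, Prefix.append, contract, prepend_cons d [0], ho]
      · refine ⟨(j, [d, e]), (j, [0, e]), ⟨z, Prod.ext rfl (prepend_cons _ _ _)⟩, fun ψ => ?_⟩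
        simp [contractPerm, Prefix.append, contract, prepend_cons _ [e], ho, he]
    · refine ⟨(j, [d]), (j, [d]), ⟨_, rfl⟩, fun ψ => ?_⟩
      simp [contractPerm, Prefix.append, contract, hd, hdo]
  · exact ⟨(j, []), (j, []), ⟨x, Prod.ext rfl (prepend_nil x)⟩, contractPerm_acts_of_ne hj ho⟩

/-- The zero sequence below the root `i`. -/
def zeroPoint (i : Fin q) : CantorSpace n q := (i, fun _ => 0)

/-- The zero sequences below all the roots. -/
def zeroPoints (n q : ℕ) [NeZero n] : Set (CantorSpace n q) := range zeroPoint

theorem nbhd_zeroPoint (i : Fin q) (N : ℕ) :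
    nbhd (zeroPoint (n := n) i) N = (i, List.replicate N 0) :=
  Prod.ext rfl (List.ofFn_const _ _)

/-- `contractPerm i ho` has degree 1 at the zero sequence below root i and degree 0 at the others,
so the standard basis vectors are attained. -/
theorem germHom_zeroPoints_surjective (hn : 2 ≤ n) :
    Surjective (germHom hn (zeroPoints n q)) := by
  classical
  have : Nontrivial (Fin n) := Fin.nontrivial_iff_two_le.2 hn
  obtain ⟨o, ho⟩ := exists_ne (0 : Fin n)
  have hz : ∀ i : Fin q, (contractPerm i ho) (zeroPoint i) = zeroPoint i := fun i => by
    refine Prod.ext rfl ?_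
    funext k
    rcases k with _ | k <;> simp [contractPerm, zeroPoint, contract]
  have hfix : ∀ i : Fin q, V.mk _ (contractPerm_isThompsonLike i ho) ∈ Fix (zeroPoints n q) := by
    rintro i _ ⟨j, rfl⟩
    change (contractPerm i ho) _ = _
    by_cases hj : j = i
    · rw [hj, hz]
    · simp [contractPerm, zeroPoint, hj]
  have key : ∀ p : zeroPoints n q,
      Multiplicative.ofAdd (Pi.single p (1 : ℤ)) ∈ (germHom hn (zeroPoints n q)).range := by
    rintro ⟨_, i, rfl⟩
    refine ⟨⟨_, hfix i⟩, ?_⟩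
    refine congrArg Multiplicative.ofAdd (funext ?_)
    rintro ⟨_, j, rfl⟩
    by_cases hj : j = i
    · subst hj
      rw [Pi.single_eq_same, degree_eq hn (M := 1) (K := 2)]
      · norm_num
      · rw [GermAt, nbhd_zeroPoint, nbhd_zeroPoint]
        exact contractPerm_acts_zero j ho
    · rw [Pi.single_eq_of_ne, degree_eq hn (M := 0) (K := 0)]
      · norm_num
      · rw [GermAt, nbhd_zeroPoint]
        exact contractPerm_acts_of_ne hj ho
      · intro h
        exact hj (congrArg (fun x : zeroPoints n q => x.1.1) h)
  have := (finite_range (zeroPoint (n := n) (q := q))).fintype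
  have : Fintype (zeroPoints n q) := this
  rw [← MonoidHom.range_eq_top, eq_top_iff]
  intro z _
  have hsum : z = ∏ p, (Multiplicative.ofAdd (Pi.single p (1 : ℤ))) ^ (Multiplicative.toAdd z p) := by
    apply Multiplicative.toAdd.injective
    rw [toAdd_prod]
    funext p
    simp [Finset.sum_apply, Pi.single_apply]
  rw [hsum]
  exact Subgroup.prod_mem _ fun p _ => Subgroup.zpow_mem _ (key p) _

end

/-! ### Conjugating stabilizers of rational points. -/

theorem tail_iterate (x : ℕ → Fin n) (m : ℕ) : tail^[m] x = fun k => x (k + m) := by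
  induction m generalizing x with
  | zero => rfl
  | succ m ih =>
    rw [iterate_succ_apply, ih]
    funext k
    simp only [tail]
    congr 1

/-- Conjugation by a bijection that is locally a prefix replacement away from the fixed points
and respects the germs there. -/
def conjEquiv {S : Set (CantorSpace n q)} {S' : Set (CantorSpace n r)}
    (h : CantorSpace n q ≃ CantorSpace n r) (hS : ∀ x, h x ∈ S' ↔ x ∈ S)
    (hloc : ∀ x ∉ S, LocalAt h x)
    (h1 : ∀ g : Fix S, ∀ y ∈ S', LocalAt (h ∘ g.1.1 ∘ h.symm) y)
    (h2 : ∀ f : Fix S', ∀ x ∈ S, LocalAt (h.symm ∘ f.1.1 ∘ h) x) : Fix S ≃* Fix S' where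
  toFun g := ⟨V.mk (h.symm.trans (g.1.1.toEquiv.trans h)) (fun y => by
      by_cases hy : y ∈ S'
      · exact h1 g y hy
      · have hx : h.symm y ∉ S := by rwa [← hS, h.apply_symm_apply]
        refine LocalAt.comp (g := h) (hloc _ fun hx' => hx ?_)
          (LocalAt.comp (g.1.2 _) (LocalAt.symm (hloc _ hx)))
        have := g.2 _ hx'
        exact g.1.1.injective this ▸ hx'), fun y hy => by
      have := g.2 (h.symm y) (by rwa [← hS, h.apply_symm_apply])
      change h (g.1.1 (h.symm y)) = y
      rw [this, h.apply_symm_apply]⟩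
  invFun f := ⟨V.mk (h.trans (f.1.1.toEquiv.trans h.symm)) (fun x => by
      by_cases hx : x ∈ S
      · exact h2 f x hx
      · have hy : h x ∉ S' := by rwa [hS]
        refine LocalAt.comp (g := h.symm) (LocalAt.symm (hloc _ fun hx' => hy ?_))
          (LocalAt.comp (f.1.2 _) (hloc _ hx))
        rw [← hS, h.apply_symm_apply] at hx'
        have := f.2 _ hx'
        exact f.1.1.injective this ▸ hx'), fun x hx => by
      have := f.2 (h x) ((hS x).2 hx)
      change h.symm (f.1.1 (h x)) = x
      rw [this, h.symm_apply_apply]⟩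
  left_inv g := Subtype.ext <| V.ext_apply fun x => by
    change h.symm (h (g.1.1 (h.symm (h x)))) = _
    simp
  right_inv f := Subtype.ext <| V.ext_apply fun x => by
    change h (h.symm (f.1.1 (h (h.symm x)))) = _
    simp
  map_mul' f g := Subtype.ext <| V.ext_apply fun x => by
    change h (f.1.1 (g.1.1 (h.symm x))) = h (f.1.1 (h.symm (h (g.1.1 (h.symm x)))))
    simp

/-- The tail of `p` after `N` digits. -/
def tailFrom (p : CantorSpace n q) (N : ℕ) : ℕ → Fin n := fun k => p.2 (k + N)

theorem tailFrom_add (p : CantorSpace n q) (N M : ℕ) :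
    tailFrom p (N + M) = tail^[M] (tailFrom p N) := by
  rw [tail_iterate]
  funext k
  simp only [tailFrom, add_assoc, add_comm M N]

theorem GermAt.tailFrom_eq {f : CantorSpace n q → CantorSpace n q} {p : CantorSpace n q}
    (hp : f p = p) {M K : ℕ} (h : GermAt f p M K) : tailFrom p M = tailFrom p K := by
  have h1 := h (tailFrom p M)
  rw [show (nbhd p M).append (tailFrom p M) = p from nbhd_append p M, hp] at h1
  exact append_injective (nbhd p K) (h1.symm.trans (nbhd_append p K).symm)

/-- The germs at a rational point are powers of the shift by the minimal period. -/
theorem exists_germ_periodic {S : Set (CantorSpace n q)} (g : Fix S) (p : S) {N : ℕ}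
    (hp : tailFrom p.1 N ∈ periodicPts tail) :
    ∃ M K, GermAt g.1.1 p (N + minimalPeriod tail (tailFrom p.1 N) * M)
      (N + minimalPeriod tail (tailFrom p.1 N) * K) := by
  set l := minimalPeriod tail (tailFrom p.1 N)
  have hl : 0 < l := minimalPeriod_pos_of_mem_periodicPts hp
  obtain ⟨N₀, hN₀⟩ := exists_germ g p
  -- A depth beyond `N₀` that differs from `N` by a multiple of the period.
  obtain ⟨K₀, hK₀⟩ := hN₀ (N + l * N₀)
    (by have := Nat.le_mul_of_pos_left N₀ hl; omega)
  -- A further multiple of the period brings the target depth past `N` too; equality of the tails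
  -- then forces its excess over `N` to be a multiple of the period.
  have hK := hK₀.add (g.2 p p.2) (l * N)
  have hle : N ≤ K₀ + l * N := by have := Nat.le_mul_of_pos_left N hl; omega
  obtain ⟨K, hK'⟩ := Nat.exists_eq_add_of_le hle
  rw [hK', add_assoc, ← mul_add] at hK
  have h := hK.tailFrom_eq (g.2 p p.2)
  rw [tailFrom_add, tailFrom_add] at h
  have hM : IsPeriodicPt tail (l * (N₀ + N)) (tailFrom p.1 N) :=
    isPeriodicPt_iff_minimalPeriod_dvd.2 (dvd_mul_right _ _)
  obtain ⟨K', rfl⟩ := isPeriodicPt_iff_minimalPeriod_dvd.1 (h.symm.trans hM)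
  exact ⟨_, K', hK⟩

/-- By `hshift`, inserting one period at `p` corresponds to inserting one 0 in the model. Germs at
`p` can be taken to change the number of periods from M to K, so conjugation turns them into changes
in the number of zeros, and conversely. `hcone` supplies a cone about the zero sequence small enough
for this description. -/
theorem nonempty_fix_mulEquiv_of_conj [NeZero n] {S : Set (CantorSpace n q)} {N : ℕ}
    (hper : ∀ p ∈ S, tailFrom p N ∈ periodicPts tail)
    (ι : S ≃ Fin r) (h : CantorSpace n q ≃ CantorSpace n r)
    (hι : ∀ p : S, h p = zeroPoint (ι p)) (hloc : ∀ x ∉ S, LocalAt h x)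
    (hshift : ∀ (p : S) M ψ,
      h ((nbhd p.1 (N + M + minimalPeriod tail (tailFrom p.1 N))).append ψ) =
        ((h ((nbhd p.1 (N + M)).append ψ)).1, prepend [0] (h ((nbhd p.1 (N + M)).append ψ)).2))
    (hroot : ∀ (p : S) ψ, (h ((nbhd p.1 N).append ψ)).1 = ι p)
    (hcone : ∃ l, ∀ (p : S) ψ,
      h.symm (Prefix.append (ι p, List.replicate l 0) ψ) ∈ cone (nbhd p.1 N)) :
    Nonempty (Fix S ≃* Fix (zeroPoints n r)) := by
  have hshift' : ∀ (p : S) M ψ,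
      h ((nbhd p.1 (N + minimalPeriod tail (tailFrom p.1 N) * M)).append ψ) =
        Prefix.append (ι p, List.replicate M 0) (h ((nbhd p.1 N).append ψ)).2 := by
    intro p M ψ
    induction M with
    | zero => exact Prod.ext (hroot p ψ) (prepend_nil _).symm
    | succ M ih =>
      rw [mul_add, mul_one, ← add_assoc, hshift, ih, List.replicate_succ]
      exact Prod.ext rfl (prepend_cons _ _ _).symm
  have hS : ∀ x, h x ∈ zeroPoints n r ↔ x ∈ S := by
    intro x
    constructor
    · rintro ⟨i, hi⟩
      have := hι (ι.symm i)
      rw [ι.apply_symm_apply, hi] at this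
      rw [← h.injective this]
      exact (ι.symm i).2
    · intro hx
      exact ⟨_, (hι ⟨x, hx⟩).symm⟩
  refine ⟨conjEquiv h hS hloc ?_ ?_⟩
  · rintro g _ ⟨i, rfl⟩
    obtain ⟨p, rfl⟩ := ι.surjective i
    obtain ⟨l, hl⟩ := hcone
    obtain ⟨M, K, hMK⟩ := exists_germ_periodic g p (hper p p.2)
    have hrep : ∀ (M : ℕ) ψ φ, (nbhd p.1 N).append φ =
        h.symm (Prefix.append (ι p, List.replicate l 0) ψ) →
        h ((nbhd p.1 (N + minimalPeriod tail (tailFrom p.1 N) * M)).append φ) =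
          Prefix.append (ι p, List.replicate (M + l) 0) ψ := by
      intro M ψ φ hφ
      rw [hshift', hφ, h.apply_symm_apply, List.replicate_add, append_append]
      rfl
    refine ⟨(ι p, List.replicate (M + l) 0), (ι p, List.replicate (K + l) 0), ?_, fun ψ => ?_⟩
    · rw [← nbhd_zeroPoint]
      exact ⟨_, nbhd_append _ _⟩
    · obtain ⟨φ, hφ⟩ := hl p ψ
      rw [comp_apply, comp_apply, ← hrep M ψ φ hφ, h.symm_apply_apply, hMK φ, hrep K ψ φ hφ]
  · intro f p hp
    obtain ⟨N₀, hN₀⟩ := exists_germ f ⟨zeroPoint (ι ⟨p, hp⟩), _, rfl⟩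
    obtain ⟨K, hK⟩ := hN₀ N₀ le_rfl
    rw [GermAt, nbhd_zeroPoint, nbhd_zeroPoint] at hK
    refine ⟨nbhd p (N + minimalPeriod tail (tailFrom p N) * N₀),
      nbhd p (N + minimalPeriod tail (tailFrom p N) * K), ⟨_, nbhd_append _ _⟩, fun ψ => ?_⟩
    rw [comp_apply, comp_apply, hshift' ⟨p, hp⟩, hK, Equiv.symm_apply_eq, hshift' ⟨p, hp⟩]

/-! ### Partitions of the complement of a sequence. -/

theorem cons_inj {d e : Fin n} {φ ψ : ℕ → Fin n} :
    prepend [d] φ = prepend [e] ψ ↔ d = e ∧ φ = ψ := by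
  rw [prepend_inj (w := [d]) (v := [e]) rfl]; simp

/-- The map `(i, ψ) ↦ uᵢψ` attached to a family of words. -/
def wordChart {I : Type*} (u : I → List (Fin n)) (z : I × (ℕ → Fin n)) : ℕ → Fin n :=
  prepend (u z.1) z.2

theorem prepend_digits_apply_of_lt (t y : ℕ → Fin n) {m k : ℕ} (h : k < m) :
    prepend (digits t m) y k = t k := by
  rw [prepend_apply_of_lt y (by simpa using h)]
  simp [digits]

theorem prepend_digits_apply (t y : ℕ → Fin n) (m : ℕ) : prepend (digits t m) y m = y 0 := by
  have := prepend_apply_add (digits t m) y 0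
  rwa [zero_add, length_digits] at this

theorem first_difference_unique {t y y' : ℕ → Fin n} {m m' : ℕ} (hy : y 0 ≠ t m)
    (hy' : y' 0 ≠ t m') (h : prepend (digits t m) y = prepend (digits t m') y') :
    m = m' ∧ y = y' := by
  have hm : m = m' := by
    rcases lt_trichotomy m m' with hm | hm | hm
    · have := congrFun h m
      rw [prepend_digits_apply, prepend_digits_apply_of_lt t y' hm] at this
      exact absurd this hy
    · exact hm
    · have := congrFun h m'
      rw [prepend_digits_apply, prepend_digits_apply_of_lt t y hm] at this
      exact absurd this.symm hy'
  subst hm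
  exact ⟨rfl, prepend_injective _ h⟩

theorem exists_first_difference {t x : ℕ → Fin n} (h : x ≠ t) :
    ∃ m y, x = prepend (digits t m) y ∧ y 0 ≠ t m := by
  classical
  have h' := Function.ne_iff.1 h
  refine ⟨Nat.find h', fun k => x (k + Nat.find h'), ?_, ?_⟩
  · rw [← digits_eq_iff.2 fun k hk => not_not.1 (Nat.find_min h' hk), prepend_digits]
  · simpa using Nat.find_spec h'

theorem prepend_digits_ne {t y : ℕ → Fin n} {m : ℕ} (hy : y 0 ≠ t m) :
    prepend (digits t m) y ≠ t := fun h => hy (by rw [← prepend_digits_apply t y m, h])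

section
variable [NeZero n]

/-- The nonzero digits. -/
abbrev NonzeroDigit (n : ℕ) [NeZero n] : Type := {d : Fin n // d ≠ 0}

/-- The words that leave the sequence `t` after `j` digits. -/
def leavingWord (t : ℕ → Fin n) (z : ℕ × NonzeroDigit n) : List (Fin n) :=
  digits t z.1 ++ [t z.1 + z.2.1]

theorem wordChart_leavingWord (t : ℕ → Fin n) (j : ℕ) (d : NonzeroDigit n) (ψ : ℕ → Fin n) :
    wordChart (leavingWord t) ((j, d), ψ) = prepend (digits t j) (prepend [t j + d.1] ψ) :=
  prepend_append _ _ _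

theorem wordChart_leavingWord_injective (t : ℕ → Fin n) :
    Injective (wordChart (leavingWord t)) := by
  rintro ⟨⟨j, d⟩, φ⟩ ⟨⟨j', d'⟩, ψ⟩ h
  rw [wordChart_leavingWord, wordChart_leavingWord] at h
  obtain ⟨rfl, h⟩ := first_difference_unique (by simpa using d.2) (by simpa using d'.2) h
  obtain ⟨h1, rfl⟩ := cons_inj.1 h
  rw [Subtype.ext (add_left_cancel h1)]

theorem mem_range_wordChart_leavingWord {t x : ℕ → Fin n} :
    x ∈ range (wordChart (leavingWord t)) ↔ x ≠ t := by
  constructor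
  · rintro ⟨⟨⟨j, d⟩, ψ⟩, rfl⟩
    rw [wordChart_leavingWord]
    exact prepend_digits_ne (by simpa using d.2)
  · intro h
    obtain ⟨m, y, rfl, hy⟩ := exists_first_difference h
    refine ⟨((m, ⟨y 0 - t m, sub_ne_zero.2 hy⟩), tail y), ?_⟩
    rw [wordChart_leavingWord]
    simp only [add_sub_cancel, cons_tail]

/-- A period in front of `t` gives `t` back, so branching off one period later is branching off
after an inserted period. -/
theorem leavingWord_add {t : ℕ → Fin n} {l : ℕ} (ht : IsPeriodicPt tail l t) (j : ℕ)
    (d : NonzeroDigit n) : leavingWord t (j + l, d) = digits t l ++ leavingWord t (j, d) := by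
  have h1 : (fun k => t (k + l)) = t := by rw [← tail_iterate]; exact ht
  simp only [leavingWord]
  rw [add_comm j l, digits_add, h1, List.append_assoc, add_comm l j]
  rw [show t (j + l) = t j from congrFun h1 j]

/-- Splitting one cone of a partition into the cones of its children. -/
theorem exists_split {I : Type*} (u : I → List (Fin n)) (i₀ : I) :
    ∃ (u' : I ⊕ NonzeroDigit n → List (Fin n))
      (π : (I ⊕ NonzeroDigit n) × (ℕ → Fin n) → I × (ℕ → Fin n)),
      Bijective π ∧ wordChart u' = wordChart u ∘ π := by
  classical
  -- Index `i₀` keeps the child 0, and the new indices are the other children.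
  refine ⟨Sum.elim (fun i => u i ++ if i = i₀ then [0] else []) fun d => u i₀ ++ [d.1],
    fun z => Sum.elim (fun i => (i, if i = i₀ then prepend [0] z.2 else z.2))
      (fun d => (i₀, prepend [d.1] z.2)) z.1, ⟨?_, ?_⟩, ?_⟩
  · rintro ⟨i | d, φ⟩ ⟨i' | d', ψ⟩ h
    · simp only [Sum.elim_inl, Prod.mk.injEq] at h
      obtain ⟨rfl, h⟩ := h
      split_ifs at h
      · rw [prepend_injective _ h]
      · rw [h]
    · simp only [Sum.elim_inl, Sum.elim_inr, Prod.mk.injEq] at h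
      obtain ⟨rfl, h⟩ := h
      rw [if_pos rfl, cons_inj] at h
      exact absurd h.1.symm d'.2
    · simp only [Sum.elim_inl, Sum.elim_inr, Prod.mk.injEq] at h
      obtain ⟨rfl, h⟩ := h
      rw [if_pos rfl, cons_inj] at h
      exact absurd h.1 d.2
    · simp only [Sum.elim_inr, Prod.mk.injEq, true_and] at h
      rw [cons_inj] at h
      rw [h.2, Subtype.ext h.1]
  · rintro ⟨i, ψ⟩
    by_cases hi : i = i₀
    · subst hi
      by_cases h0 : ψ 0 = 0
      · refine ⟨(Sum.inl i, tail ψ), ?_⟩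
        have := cons_tail ψ
        rw [h0] at this
        simp [this]
      · exact ⟨(Sum.inr ⟨ψ 0, h0⟩, tail ψ), by simp [cons_tail]⟩
    · exact ⟨(Sum.inl i, ψ), by simp [hi]⟩
  · funext ⟨i, ψ⟩
    rcases i with i | d
    · by_cases hi : i = i₀
      · simp [wordChart, hi, prepend_append]
      · simp [wordChart, hi]
    · simp [wordChart, prepend_append]

/-- The n − 1 cones of the nonzero digits form the first partition; each split adds n − 1 cones, so
every multiple of n − 1 is reached. -/
theorem exists_ring_words (hn : 2 ≤ n) (l : ℕ) :
    ∃ u : Fin (l + 1) × NonzeroDigit n → List (Fin n), Injective (wordChart u) ∧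
      ∀ x, x ∈ range (wordChart u) ↔ x 0 ≠ 0 := by
  have : Nontrivial (Fin n) := Fin.nontrivial_iff_two_le.2 hn
  induction l with
  | zero =>
    refine ⟨fun z => [z.2.1], ?_, fun x => ⟨?_, fun h => ?_⟩⟩
    · rintro ⟨⟨i, d⟩, φ⟩ ⟨⟨j, e⟩, ψ⟩ h
      obtain ⟨h1, h2⟩ := cons_inj.1 h
      exact Prod.ext (Prod.ext (Subsingleton.elim (α := Fin 1) i j) (Subtype.ext h1)) h2
    · rintro ⟨⟨⟨i, d⟩, φ⟩, rfl⟩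
      simpa [wordChart] using d.2
    · exact ⟨((0, ⟨x 0, h⟩), tail x), cons_tail x⟩
  | succ l ih =>
    obtain ⟨u, hu, hr⟩ := ih
    obtain ⟨o, ho⟩ := exists_ne (0 : Fin n)
    obtain ⟨u', π, hπ, h⟩ := exists_split u (0, ⟨o, ho⟩)
    let e : Fin (l + 1 + 1) × NonzeroDigit n ≃ (Fin (l + 1) × NonzeroDigit n) ⊕ NonzeroDigit n :=
      Fintype.equivOfCardEq (by
        rw [Fintype.card_sum, Fintype.card_prod, Fintype.card_prod, Fintype.card_fin,
          Fintype.card_fin]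
        ring)
    have h' : wordChart (u' ∘ e) = wordChart u ∘ (π ∘ Equiv.prodCongr e (Equiv.refl _)) := by
      rw [← comp_assoc, ← h]; rfl
    refine ⟨u' ∘ e, ?_, fun x => ?_⟩
    · rw [h']
      exact hu.comp (hπ.1.comp (Equiv.injective _))
    · rw [h', (hπ.2.comp (Equiv.surjective _)).range_comp, hr]

/-- A partition of the nonzero sequences into cones that is periodic of period `l`. -/
theorem exists_zero_words (hn : 2 ≤ n) {l : ℕ} (hl : 0 < l) :
    ∃ B : ℕ × NonzeroDigit n → List (Fin n), Injective (wordChart B) ∧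
      (∀ x, x ∈ range (wordChart B) ↔ x ≠ fun _ => 0) ∧
      (∀ j d, B (j + l, d) = 0 :: B (j, d)) ∧
      ∀ j d ψ, ∃ k ≤ j, wordChart B ((j, d), ψ) k ≠ 0 := by
  obtain ⟨l, rfl⟩ := Nat.exists_eq_succ_of_ne_zero hl.ne'
  obtain ⟨u, hu, hr⟩ := exists_ring_words hn l
  let zero : ℕ → Fin n := fun _ => 0
  let e : ℕ × NonzeroDigit n → Fin (l + 1) × NonzeroDigit n := fun z =>
    (⟨z.1 % (l + 1), Nat.mod_lt _ hl⟩, z.2)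
  have hz : ∀ z, wordChart u z 0 ≠ 0 := fun z => (hr _).1 ⟨z, rfl⟩
  -- The quotient of the index by the period counts the leading zeros, and the remainder selects a
  -- cone of the ring.
  let B : ℕ × NonzeroDigit n → List (Fin n) := fun z => digits zero (z.1 / (l + 1)) ++ u (e z)
  have hB : ∀ z ψ, wordChart B (z, ψ) =
      prepend (digits zero (z.1 / (l + 1))) (wordChart u (e z, ψ)) := fun z ψ =>
    prepend_append _ _ _
  refine ⟨B, ?_, fun x => ⟨?_, fun h => ?_⟩, fun j d => ?_, fun j d ψ => ?_⟩
  · rintro ⟨⟨j, d⟩, φ⟩ ⟨⟨j', d'⟩, ψ⟩ h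
    rw [hB, hB] at h
    obtain ⟨h1, h2⟩ := first_difference_unique (hz _) (hz _) h
    have := hu h2
    simp only [e, Prod.mk.injEq, Fin.mk.injEq] at this
    obtain ⟨⟨h3, rfl⟩, rfl⟩ := this
    simp only at h1
    rw [← Nat.div_add_mod j (l + 1), ← Nat.div_add_mod j' (l + 1), h1, h3]
  · rintro ⟨⟨z, ψ⟩, rfl⟩
    rw [hB]
    exact prepend_digits_ne (hz _)
  · obtain ⟨m, y, rfl, hy⟩ := exists_first_difference h
    obtain ⟨⟨⟨i, d⟩, ψ⟩, rfl⟩ := (hr y).2 hy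
    refine ⟨((i + (l + 1) * m, d), ψ), ?_⟩
    rw [hB]
    have h1 : (i + (l + 1) * m) / (l + 1) = m := by
      rw [Nat.add_mul_div_left _ _ hl, Nat.div_eq_of_lt i.2, zero_add]
    have h2 : e (i + (l + 1) * m, d) = (i, d) :=
      Prod.ext (Fin.ext (by simp [e, Nat.mod_eq_of_lt i.2])) rfl
    rw [h2]
    simp only [h1, zero]
  · simp only [B]
    have h1 : e (j + (l + 1), d) = e (j, d) := by simp [e]
    rw [h1, Nat.add_div_right _ hl]
    have : ∀ m, digits zero m = List.replicate m 0 := fun m => List.ofFn_const _ _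
    rw [this, this, List.replicate_succ, List.cons_append]
  · refine ⟨j / (l + 1), Nat.div_le_self _ _, ?_⟩
    rw [hB, prepend_digits_apply]
    exact hz _

end

/-! ### Construction of the conjugating bijection. -/

theorem exists_equiv_of_charts {I : Type*} {a : I → Prefix n q} {b : I → Prefix n r}
    {S : Set (CantorSpace n q)} {S' : Set (CantorSpace n r)}
    (ha : Injective (chart a)) (hb : Injective (chart b))
    (haS : ∀ x, x ∈ range (chart a) ↔ x ∉ S) (hbS : ∀ y, y ∈ range (chart b) ↔ y ∉ S')
    (ι : S ≃ S') :
    ∃ h : CantorSpace n q ≃ CantorSpace n r, (∀ p : S, h p = ι p) ∧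
      ∀ i ψ, h ((a i).append ψ) = (b i).append ψ := by
  classical
  let κ : (Sᶜ : Set _) ≃ (S'ᶜ : Set _) :=
    (Equiv.setCongr (Set.ext haS)).symm.trans ((Equiv.ofInjective _ ha).symm.trans
      ((Equiv.ofInjective _ hb).trans (Equiv.setCongr (Set.ext hbS))))
  refine ⟨(Equiv.Set.sumCompl S).symm.trans ((Equiv.sumCongr ι κ).trans (Equiv.Set.sumCompl S')),
    fun p => ?_, fun i ψ => ?_⟩
  · simp [Equiv.Set.sumCompl_symm_apply_of_mem p.2]
  · have hx : (a i).append ψ ∉ S := (haS _).1 ⟨(i, ψ), rfl⟩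
    simp only [Equiv.trans_apply, Equiv.Set.sumCompl_symm_apply_of_notMem hx,
      Equiv.sumCongr_apply, Sum.map_inr, Equiv.Set.sumCompl_apply_inr]
    have : (Equiv.ofInjective _ ha).symm ⟨(a i).append ψ, (i, ψ), rfl⟩ = (i, ψ) :=
      (Equiv.ofInjective _ ha).symm_apply_apply (i, ψ)
    change ((Equiv.ofInjective _ hb) ((Equiv.ofInjective _ ha).symm
      ⟨(a i).append ψ, (i, ψ), rfl⟩)).1 = _
    rw [this]
    rfl

section
variable [NeZero n] {S : Set (CantorSpace n q)} {N : ℕ}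

/-- Prefixes whose cones partition the complement of `S`: those that leave a point of `S` after
at least `N` digits, and the words of length `N` that are not prefixes of points of `S`. -/
def complementPrefix (S : Set (CantorSpace n q)) (N : ℕ) :
    (S × (ℕ × NonzeroDigit n)) ⊕ OffLevel S N → Prefix n q
  | .inl z => (z.1.1.1, digits z.1.1.2 N ++ leavingWord (tailFrom z.1.1 N) z.2)
  | .inr v => levelPrefix v.1

theorem complementPrefix_inl_append (p : S) (z : ℕ × NonzeroDigit n) (ψ : ℕ → Fin n) :
    (complementPrefix S N (.inl (p, z))).append ψ =
      (nbhd p.1 N).append (wordChart (leavingWord (tailFrom p.1 N)) (z, ψ)) :=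
  append_append _ _ _ _

theorem chart_complementPrefix_injective (hsep : S.InjOn fun p => nbhd p N) :
    Injective (chart (complementPrefix S N)) := by
  have key : ∀ (p : S) z φ (v : OffLevel S N) ψ,
      (complementPrefix S N (.inl (p, z))).append φ ≠ (levelPrefix v.1).append ψ := by
    intro p z φ v ψ h
    rw [complementPrefix_inl_append] at h
    exact mem_range_chart_offLevel.1 ⟨(v, ψ), rfl⟩ p p.2 ⟨_, h⟩
  rintro ⟨⟨p, z⟩ | v, φ⟩ ⟨⟨p', z'⟩ | v', ψ⟩ h
  · have h' : (complementPrefix S N (.inl (p, z))).append φ =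
      (complementPrefix S N (.inl (p', z'))).append ψ := h
    rw [complementPrefix_inl_append, complementPrefix_inl_append] at h'
    obtain rfl : p = p' := by
      have h1 := mem_cone_nbhd_iff.1 ⟨_, h'⟩
      exact Subtype.ext (hsep p.2 p'.2 (h1.symm.trans (mem_cone_nbhd_iff.1 ⟨_, rfl⟩)))
    have := wordChart_leavingWord_injective _ (append_injective _ h')
    simp only [Prod.mk.injEq] at this
    rw [this.1, this.2]
  · exact absurd h (key _ _ _ _ _)
  · exact absurd h.symm (key _ _ _ _ _)
  · have := chart_offLevel_injective (a₁ := (v, φ)) (a₂ := (v', ψ)) h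
    simp only [Prod.mk.injEq] at this
    rw [this.1, this.2]

theorem mem_range_chart_complementPrefix (hsep : S.InjOn fun p => nbhd p N)
    (x : CantorSpace n q) : x ∈ range (chart (complementPrefix S N)) ↔ x ∉ S := by
  constructor
  · rintro ⟨⟨⟨p, z⟩ | v, φ⟩, rfl⟩ hx
    · change (complementPrefix S N (.inl (p, z))).append φ ∈ S at hx
      rw [complementPrefix_inl_append] at hx
      have h1 := hsep hx p.2 (mem_cone_nbhd_iff.1 ⟨_, rfl⟩)
      have h2 : _ ≠ tailFrom p.1 N := mem_range_wordChart_leavingWord.1 ⟨(z, φ), rfl⟩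
      exact h2 (append_injective (nbhd p.1 N) (h1.trans (nbhd_append _ _).symm))
    · exact mem_range_chart_offLevel.1 ⟨(v, φ), rfl⟩ _ hx ⟨_, nbhd_append _ N⟩
  · intro hx
    by_cases h : ∃ p ∈ S, x ∈ cone (nbhd p N)
    · obtain ⟨p, hp, ψ, rfl⟩ := h
      have : ψ ≠ tailFrom p N := by
        rintro rfl
        exact hx ((nbhd_append p N).symm ▸ hp)
      obtain ⟨⟨z, φ⟩, rfl⟩ := mem_range_wordChart_leavingWord.2 this
      exact ⟨(.inl (⟨p, hp⟩, z), φ), complementPrefix_inl_append _ _ _⟩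
    · push Not at h
      obtain ⟨⟨v, φ⟩, h⟩ := mem_range_chart_offLevel.2 h
      exact ⟨(.inr v, φ), h⟩

end

/-- Absorbing finitely many extra indices into a periodic family. -/
theorem exists_absorb {A D L : Type*} [Finite L] (a₀ : A) (d₀ : D) :
    ∃ τ : (A × (ℕ × D)) ⊕ L → A × (ℕ × D), Bijective τ ∧
      (∀ a j d, ∃ j', ∀ m, τ (.inl (a, (j + m, d))) = (a, (j' + m, d))) ∧
      ∃ l, ∀ a j d, l ≤ j → ∃ j', τ (.inl (a, (j', d))) = (a, (j, d)) := by
  classical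
  let e := Finite.equivFin L
  -- Hilbert's hotel: only the sequence at `(a₀, d₀)` moves up, by the number of extra indices,
  -- which take the freed initial places.
  let s : A → D → ℕ := fun a d => if a = a₀ ∧ d = d₀ then Nat.card L else 0
  have hs : s a₀ d₀ = Nat.card L := if_pos ⟨rfl, rfl⟩
  refine ⟨Sum.elim (fun z => (z.1, (z.2.1 + s z.1 z.2.2, z.2.2)))
    fun v => (a₀, ((e v).1, d₀)), ⟨?_, ?_⟩, fun a j d => ⟨j + s a d, fun m => ?_⟩,
    Nat.card L, fun a j d hj => ?_⟩
  · rintro (⟨a, j, d⟩ | v) (⟨a', j', d'⟩ | v') h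
    · simp only [Sum.elim_inl, Prod.mk.injEq] at h
      obtain ⟨rfl, h, rfl⟩ := h
      rw [add_right_cancel h]
    · simp only [Sum.elim_inl, Sum.elim_inr, Prod.mk.injEq] at h
      obtain ⟨rfl, h, rfl⟩ := h
      have := (e v').2
      omega
    · simp only [Sum.elim_inl, Sum.elim_inr, Prod.mk.injEq] at h
      obtain ⟨rfl, h, rfl⟩ := h
      have := (e v).2
      omega
    · simp only [Sum.elim_inr, Prod.mk.injEq, true_and, and_true] at h
      rw [e.injective (Fin.ext h)]
  · rintro ⟨a, j, d⟩
    by_cases h : s a d ≤ j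
    · exact ⟨.inl (a, (j - s a d, d)), by simp [Nat.sub_add_cancel h]⟩
    · have h' : a = a₀ ∧ d = d₀ := by
        by_contra h'
        simp [s, h'] at h
      obtain ⟨rfl, rfl⟩ := h'
      rw [hs] at h
      exact ⟨.inr (e.symm ⟨j, by omega⟩), by simp⟩
  · simp only [Sum.elim_inl]
    rw [add_right_comm]
  · have h : s a d ≤ j := by
      simp only [s]
      split_ifs <;> omega
    exact ⟨j - s a d, by simp [Nat.sub_add_cancel h]⟩

/-- Cones branching off `p` go to cones around the zero sequence below root `ι p`, after absorption
of the leftover cones. Absorption only translates each sequence of indices, so adding a period to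
the index remains compatible with prepending 0. -/
theorem nonempty_fix_mulEquiv_of_separated [NeZero n] (hn : 2 ≤ n) {S : Set (CantorSpace n q)}
    {N : ℕ} (hper : ∀ p ∈ S, tailFrom p N ∈ periodicPts tail)
    (hsep : S.InjOn fun p => nbhd p N) (ι : S ≃ Fin r) (p₀ : S) :
    Nonempty (Fix S ≃* Fix (zeroPoints n r)) := by
  have : Nontrivial (Fin n) := Fin.nontrivial_iff_two_le.2 hn
  obtain ⟨o, ho⟩ := exists_ne (0 : Fin n)
  let t : S → ℕ → Fin n := fun p => tailFrom p.1 N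
  let l : S → ℕ := fun p => minimalPeriod tail (t p)
  have hl : ∀ p, 0 < l p := fun p => minimalPeriod_pos_of_mem_periodicPts (hper p p.2)
  have htl : ∀ p, IsPeriodicPt tail (l p) (t p) := fun p => isPeriodicPt_minimalPeriod _ _
  choose B hBinj hBrange hBadd hBne using fun p => exists_zero_words hn (hl p)
  obtain ⟨τ, hτ, hτadd, L, hτL⟩ := exists_absorb (L := OffLevel S N) p₀
    (⟨o, ho⟩ : NonzeroDigit n)
  let b₀ : S × (ℕ × NonzeroDigit n) → Prefix n r := fun z => (ι z.1, B z.1 z.2)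
  let b := b₀ ∘ τ
  have hb₀ : Injective (chart b₀) := by
    rintro ⟨⟨p, z⟩, φ⟩ ⟨⟨p', z'⟩, ψ⟩ h
    obtain ⟨h1, h2⟩ := Prod.ext_iff.1 h
    obtain rfl : p = p' := ι.injective h1
    have := hBinj p (a₁ := (z, φ)) (a₂ := (z', ψ)) h2
    simp only [Prod.mk.injEq] at this
    rw [this.1, this.2]
  have hb₀range : ∀ y, y ∈ range (chart b₀) ↔ y ∉ zeroPoints n r := by
    intro y
    constructor
    · rintro ⟨⟨⟨p, z⟩, φ⟩, rfl⟩ ⟨i, hi⟩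
      exact (hBrange p _).1 ⟨(z, φ), rfl⟩ (congrArg Prod.snd hi).symm
    · intro hy
      have : y.2 ≠ fun _ => 0 := fun h => hy ⟨y.1, Prod.ext rfl h.symm⟩
      obtain ⟨⟨z, φ⟩, hz⟩ := (hBrange (ι.symm y.1) _).2 this
      exact ⟨((ι.symm y.1, z), φ), Prod.ext (ι.apply_symm_apply _) hz⟩
  have hb : chart b = chart b₀ ∘ Prod.map τ id := rfl
  have hτ' : Bijective (Prod.map τ (id : (ℕ → Fin n) → _)) := hτ.prodMap bijective_id
  have hzero : Injective (zeroPoint (n := n) (q := r)) := fun i j h => congrArg Prod.fst h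
  obtain ⟨h, hι, hh⟩ := exists_equiv_of_charts (chart_complementPrefix_injective hsep)
    (b := b) (S' := zeroPoints n r) (by rw [hb]; exact hb₀.comp hτ'.1)
    (mem_range_chart_complementPrefix hsep)
    (fun y => by rw [hb, hτ'.2.range_comp, hb₀range])
    (ι.trans (Equiv.ofInjective _ hzero))
  have hι' : ∀ p : S, h p = zeroPoint (ι p) := hι
  have hcases : ∀ (p : S) (ψ : ℕ → Fin n), ψ = t p ∨ ∃ j d φ,
      ψ = wordChart (leavingWord (t p)) ((j, d), φ) := by
    intro p ψ
    by_cases hψ : ψ = t p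
    · exact Or.inl hψ
    · obtain ⟨⟨⟨j, d⟩, φ⟩, h⟩ := mem_range_wordChart_leavingWord.2 hψ
      exact Or.inr ⟨j, d, φ, h.symm⟩
  have hpt : ∀ p : S, (nbhd p.1 N).append (t p) = p := fun p => nbhd_append p.1 N
  have hroot : ∀ (p : S) ψ, (h ((nbhd p.1 N).append ψ)).1 = ι p := by
    intro p ψ
    rcases hcases p ψ with rfl | ⟨j, d, φ, rfl⟩
    · rw [hpt, hι']; rfl
    · rw [← complementPrefix_inl_append, hh]
      obtain ⟨j', hj'⟩ := hτadd p j d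
      have := hj' 0
      simp only [add_zero] at this
      simp only [b, comp_apply, this]
      rfl
  have happ : ∀ (p : S) M ψ, (nbhd p.1 (N + M)).append ψ =
      (nbhd p.1 N).append (prepend (digits (t p) M) ψ) := by
    intro p M ψ
    rw [nbhd, digits_add]
    exact append_append _ _ _ _
  have hshift₀ : ∀ (p : S) ψ, h ((nbhd p.1 N).append (prepend (digits (t p) (l p)) ψ)) =
      ((h ((nbhd p.1 N).append ψ)).1, prepend [0] (h ((nbhd p.1 N).append ψ)).2) := by
    intro p ψ
    rcases hcases p ψ with rfl | ⟨j, d, φ, rfl⟩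
    · have h1 : prepend (digits (t p) (l p)) (t p) = t p := by
        conv_rhs => rw [← prepend_digits (t p) (l p)]
        rw [← tail_iterate, htl p]
      rw [h1, hpt, hι']
      refine Prod.ext rfl ?_
      funext k
      rcases k with _ | k <;> simp [zeroPoint]
    · have h1 : prepend (digits (t p) (l p)) (wordChart (leavingWord (t p)) ((j, d), φ)) =
          wordChart (leavingWord (t p)) ((j + l p, d), φ) := by
        simp only [wordChart, leavingWord_add (htl p), prepend_append]
      obtain ⟨j', hj'⟩ := hτadd p j d
      have h0 := hj' 0
      simp only [add_zero] at h0
      rw [h1, ← complementPrefix_inl_append, ← complementPrefix_inl_append, hh, hh]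
      simp only [b, comp_apply, hj', h0, b₀, hBadd]
      exact Prod.ext rfl (prepend_cons _ _ _)
  refine nonempty_fix_mulEquiv_of_conj hper ι h hι'
    (fun x hx => localAt_of_chart hh ((mem_range_chart_complementPrefix hsep x).2 hx))
    (fun p M ψ => ?_) hroot ⟨L, fun p ψ => ?_⟩
  · have h1 : digits (t p) (l p + M) = digits (t p) (l p) ++ digits (t p) M := by
      rw [digits_add, ← tail_iterate, htl p]
    have h2 := hshift₀ p (prepend (digits (t p) M) ψ)
    rw [← prepend_append, ← h1, add_comm, ← happ, ← happ, ← add_assoc] at h2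
    exact h2
  · by_cases hy : Prefix.append (ι p, List.replicate L 0) ψ ∈ zeroPoints n r
    · obtain ⟨i, hi⟩ := hy
      have : i = ι p := congrArg Prod.fst hi
      rw [← hi, this, ← hι', h.symm_apply_apply]
      exact ⟨_, hpt p⟩
    · obtain ⟨⟨⟨p', j, d⟩, φ⟩, hφ⟩ := (hb₀range _).2 hy
      obtain rfl : p' = p := ι.injective (congrArg Prod.fst hφ)
      have hφ2 : wordChart (B p') ((j, d), φ) = prepend (List.replicate L 0) ψ :=
        congrArg Prod.snd hφ
      obtain ⟨k, hk, hne⟩ := hBne p' j d φ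
      -- A cone of index `j` has a nonzero digit at a position at most `j`, so meeting the cone of L
      -- zeros forces `j` past the places taken by leftover cones.
      have hLj : L ≤ j := by
        by_contra hlt
        apply hne
        rw [hφ2, prepend_apply_of_lt _ (by simp; omega)]
        simp
      obtain ⟨j', hj'⟩ := hτL p' j d hLj
      have : h ((complementPrefix S N (.inl (p', (j', d)))).append φ) =
          Prefix.append (ι p', List.replicate L 0) ψ := by
        rw [hh, ← hφ]
        simp only [b, comp_apply, hj']
        rfl
      rw [← this, h.symm_apply_apply, complementPrefix_inl_append]
      exact ⟨_, rfl⟩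

/-! ### Reduction to zero sequences and conclusion. -/

theorem IsRational.eventually_mem_periodicPts {p : CantorSpace n q} (hp : IsRational p) :
    ∀ᶠ N in Filter.atTop, tailFrom p N ∈ periodicPts tail := by
  obtain ⟨N, m, hm, h⟩ := hp
  filter_upwards [Filter.eventually_ge_atTop N] with M hM
  refine ⟨m, hm, ?_⟩
  rw [IsPeriodicPt, IsFixedPt, tail_iterate]
  funext k
  simp only [tailFrom]
  rw [← h (k + M) (by omega), add_right_comm]

theorem eventually_nbhd_ne {p p' : CantorSpace n q} (h : p ≠ p') :
    ∀ᶠ N in Filter.atTop, nbhd p N ≠ nbhd p' N := by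
  by_cases h1 : p.1 = p'.1
  · have h2 : p.2 ≠ p'.2 := fun h2 => h (Prod.ext h1 h2)
    obtain ⟨k, hk⟩ := Function.ne_iff.1 h2
    filter_upwards [Filter.eventually_gt_atTop k] with N hN heq
    exact hk (digits_eq_iff.1 (congrArg Prod.snd heq) k hN)
  · exact Filter.Eventually.of_forall fun N heq => h1 (congrArg (fun α : Prefix n q => α.1) heq)

/-- A large depth separates the finitely many points and lies beyond all their preperiods. -/
theorem nonempty_fix_mulEquiv_zeroPoints [NeZero n] (hn : 2 ≤ n) {S : Finset (CantorSpace n q)}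
    (hS : ∀ p ∈ S, IsRational p) (hne : S.Nonempty) :
    Nonempty (Fix (S : Set (CantorSpace n q)) ≃* Fix (zeroPoints n S.card)) := by
  have h1 : ∀ᶠ N in Filter.atTop, ∀ p ∈ S, tailFrom p N ∈ periodicPts tail :=
    (Filter.eventually_all_finset S).2 fun p hp => (hS p hp).eventually_mem_periodicPts
  have h2 : ∀ᶠ N in Filter.atTop, ∀ p ∈ S, ∀ p' ∈ S, nbhd p N = nbhd p' N → p = p' := by
    refine (Filter.eventually_all_finset S).2 fun p _ =>
      (Filter.eventually_all_finset S).2 fun p' _ => ?_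
    by_cases h : p = p'
    · exact Filter.Eventually.of_forall fun _ _ => h
    · filter_upwards [eventually_nbhd_ne h] with N hN h'
      exact absurd h' hN
  obtain ⟨N, h1, h2⟩ := (h1.and h2).exists
  obtain ⟨p₀, hp₀⟩ := hne
  exact nonempty_fix_mulEquiv_of_separated hn (S := (S : Set (CantorSpace n q))) h1
    (fun p hp p' hp' => h2 p hp p' hp') S.equivFin ⟨p₀, hp₀⟩

/-- `G` is free abelian of rank `k` modulo its elements of finite order. -/
def HasFreeRank (G : Type) [Group G] (k : ℕ) : Prop :=
  ∃ (A : Type) (_ : Fintype A) (φ : G →* Multiplicative (A → ℤ)), Fintype.card A = k ∧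
    Surjective φ ∧ φ.ker ≤ torsionClosure G

theorem HasFreeRank.eq_of_mulEquiv {G H : Type} [Group G] [Group H] {k l : ℕ}
    (hG : HasFreeRank G k) (hH : HasFreeRank H l) (e : G ≃* H) : k = l := by
  obtain ⟨A, _, φ, rfl, hφ, hk⟩ := hG
  obtain ⟨B, _, ψ, rfl, hψ, hk'⟩ := hH
  exact card_eq_of_mulEquiv e φ hφ hk ψ hψ hk'

theorem HasFreeRank.of_mulEquiv {G H : Type} [Group G] [Group H] {k : ℕ}
    (hH : HasFreeRank H k) (e : G ≃* H) : HasFreeRank G k := by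
  obtain ⟨A, _, φ, hA, hφ, hk⟩ := hH
  refine ⟨A, _, φ.comp e.toMonoidHom, hA, hφ.comp e.surjective, fun g hg => ?_⟩
  apply torsionClosure_map_le e.symm.toMonoidHom
  exact ⟨e g, hk hg, e.symm_apply_apply g⟩

theorem hasFreeRank_fix (hn : 2 ≤ n) {S : Finset (CantorSpace n q)}
    (hS : ∀ p ∈ S, IsRational p) : HasFreeRank (Fix (S : Set (CantorSpace n q))) S.card := by
  have : NeZero n := ⟨by omega⟩
  rcases S.eq_empty_or_nonempty with rfl | hne
  -- Without points to fix, the germ homomorphism has trivial target and is already surjective.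
  · refine ⟨_, inferInstance, germHom hn _, Fintype.card_coe _, fun z => ⟨1, ?_⟩,
      ker_germHom_le hn (Finset.finite_toSet _)⟩
    funext p
    exact absurd p.2 (Finset.notMem_empty _)
  · obtain ⟨e⟩ := nonempty_fix_mulEquiv_zeroPoints hn hS hne
    have hzero : Injective (zeroPoint (n := n) (q := S.card)) := fun i j h => congrArg Prod.fst h
    have : Fintype (zeroPoints n S.card) := Fintype.ofFinite (range _)
    refine HasFreeRank.of_mulEquiv ⟨_, this, germHom hn _, ?_,
      germHom_zeroPoints_surjective hn, ker_germHom_le hn (Set.finite_range _)⟩ e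
    have e₂ : Fin S.card ≃ zeroPoints n S.card := Equiv.ofInjective _ hzero
    rw [← Fintype.card_congr e₂, Fintype.card_fin]

end HigmanThompson

theorem mainTheorem5 (n q r : ℕ) (hn : 2 ≤ n) (hq : 1 ≤ q) (hr : 1 ≤ r)
    (S : Finset (HigmanThompson.CantorSpace n q)) (S' : Finset (HigmanThompson.CantorSpace n r))
    (hS : ∀ p ∈ S, HigmanThompson.IsRational p) (hS' : ∀ p ∈ S', HigmanThompson.IsRational p)
    (hne : S.Nonempty ∨ S'.Nonempty) :
    Nonempty (HigmanThompson.Fix (S : Set (HigmanThompson.CantorSpace n q)) ≃*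
        HigmanThompson.Fix (S' : Set (HigmanThompson.CantorSpace n r))) ↔
      S.card = S'.card := by
  have : NeZero n := ⟨by omega⟩
  constructor
  · rintro ⟨e⟩
    exact (HigmanThompson.hasFreeRank_fix hn hS).eq_of_mulEquiv
      (HigmanThompson.hasFreeRank_fix hn hS') e
  · intro h
    have h1 : S.Nonempty := by
      rw [← Finset.card_pos] at hne ⊢
      rw [← Finset.card_pos] at hne
      omega
    have h2 : S'.Nonempty := by
      rw [← Finset.card_pos] at h1 ⊢
      omega
    obtain ⟨e⟩ := HigmanThompson.nonempty_fix_mulEquiv_zeroPoints hn hS h1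
    obtain ⟨e'⟩ := HigmanThompson.nonempty_fix_mulEquiv_zeroPoints hn hS' h2
    rw [← h] at e'
    exact ⟨e.trans e'.symm⟩
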